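/- Let $\varepsilon>0$, $f\in L^2(0,1)$, $V=Q=H^1_0(0,1)$, $a_0(u,v)=\int_0^1 u'v'\,dx$, $|u|=a_0(u,u)^{1/2}$, $(f,v)=\int_0^1 fv\,dx$ and $b(v,u)=\varepsilon a_0(u,v)+(u',v)$. Let $u\in V$ be the weak solution of $-\varepsilon u''+u'=f$ on $(0,1)$, $u(0)=u(1)=0$, i.e. $b(v,u)=(f,v)$ for all $v\in V$. Let $n\ge 1$, $h=1/n$, $x_j=jh$, let $\mathcal M_h\subset V$ be the space of continuous functions that are linear on each $[x_{j-1},x_j]$ and vanish at $0$ and $1$, with nodal functions $\varphi_j$, put $B_i=4\varphi_{i-1}\varphi_i$ ($1\le i\le n$) and $V_h=\operatorname{span}\{\varphi_j+B_j-B_{j+1}: 1\le j\le n-1\}$. Let $u_h\in\mathcal M_h$ be the upwinding Petrov--Galerkin solution: $b(v_h,u_h)=(f,v_h)$ for all $v_h\in V_h$. Let $T:V\to V$ be given by $a_0(Tu,q)=(u',q)$ for all $q\in V$, let $P_h:V\to\mathcal M_h$ be the $a_0$-orthogonal projection, and define on all of $V$ the norm $$\|u\|_{*,h}=\Big(\tfrac{3}{19}\big((\varepsilon+\tfrac{2h}{3})^2|u|^2+|P_hTu|^2\big)\Big)^{1/2}.$$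 **Theorem.** (i) On $\mathcal M_h$ this is the discrete optimal trial norm: for $w_h\in\mathcal M_h$, $\|w_h\|_{*,h}=\sup_{v_h\in V_h} b(v_h,w_h)/|v_h|$ (with the quotient read as $0$ for $v_h=0$). (ii) $$\|u-u_h\|_{*,h}\le\sqrt{\tfrac{19}{3}}\;\inf_{p_h\in\mathcal M_h}\|u-p_h\|_{*,h}.$$ (iii) There is an absolute constant $C>0$ (independent of $\varepsilon,h,f,u$) such that, whenever $u\in H^2(0,1)$, $$\|u-u_h\|_{*,h}\le \varepsilon\, C\|u''\|_{L^2}\,h+C\|u''\|_{L^2}\,h^2,$$ that is, $\|u-u_h\|_{*,h}\le\varepsilon\,\mathcal O(h)+\mathcal O(h^2)$. -/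

import Mathlib

open MeasureTheory Set

namespace ConvDiff

noncomputable section

/-! ## The space H^1_0(0,1) -/

theorem ac_congr {f g : ℝ → ℝ} {a b : ℝ} (hf : AbsolutelyContinuousOnInterval f a b)
    (h : ∀ x ∈ uIcc a b, f x = g x) : AbsolutelyContinuousOnInterval g a b := by
  rw [absolutelyContinuousOnInterval_iff] at hf ⊢
  intro ε hε
  obtain ⟨δ, hδ, H⟩ := hf ε hε
  refine ⟨δ, hδ, fun E hE hs => ?_⟩
  have h1 := H E hE hs
  refine lt_of_eq_of_lt (Finset.sum_congr rfl fun i hi => ?_) h1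
  have h2 := hE.1 i hi
  rw [h _ h2.1, h _ h2.2]

theorem ae_differentiableAt_Ioo {u : ℝ → ℝ} (hu : AbsolutelyContinuousOnInterval u 0 1) :
    ∀ᵐ x ∂(volume.restrict (Ioo (0 : ℝ) 1)), DifferentiableAt ℝ u x := by
  rw [ae_restrict_iff' measurableSet_Ioo]
  filter_upwards [hu.ae_differentiableAt] with x hx hx1
  exact hx (by rw [uIcc_of_le zero_le_one]; exact Ioo_subset_Icc_self hx1)

/-- The Sobolev space `H^1_0(0,1)`. In one dimension its elements are exactly the absolutely
continuous functions on `[0,1]` with square integrable derivative and zero boundary values (every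
class has a unique continuous representative, and the weak derivative is the almost everywhere
derivative). The functions are extended by zero outside `(0,1)`. -/
def H10 : Submodule ℝ (ℝ → ℝ) where
  carrier := {u | AbsolutelyContinuousOnInterval u 0 1 ∧
    MemLp (deriv u) 2 (volume.restrict (Ioo (0 : ℝ) 1)) ∧ ∀ x, x ∉ Ioo (0 : ℝ) 1 → u x = 0}
  add_mem' := by
    rintro u v ⟨hu, hu', hu0⟩ ⟨hv, hv', hv0⟩
    refine ⟨hu.add hv, ?_, fun x hx => by simp [hu0 x hx, hv0 x hx]⟩
    refine (memLp_congr_ae ?_).2 (hu'.add hv')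
    filter_upwards [ae_differentiableAt_Ioo hu, ae_differentiableAt_Ioo hv] with x h1 h2
    simpa using deriv_add h1 h2
  zero_mem' := by
    refine ⟨?_, ?_, fun _ _ => rfl⟩
    · have : LipschitzOnWith 0 (0 : ℝ → ℝ) (uIcc 0 1) := (LipschitzWith.const 0).lipschitzOnWith
      exact this.absolutelyContinuousOnInterval
    · have : deriv (0 : ℝ → ℝ) = 0 := by ext x; simp
      rw [this]; exact MemLp.zero
  smul_mem' := by
    rintro c u ⟨hu, hu', hu0⟩
    refine ⟨hu.const_smul c, ?_, fun x hx => by simp [hu0 x hx]⟩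
    refine (memLp_congr_ae ?_).2 (hu'.const_smul c)
    filter_upwards [ae_differentiableAt_Ioo hu] with x h1
    simpa using deriv_const_smul c h1

/-- Membership in `H^2(0,1)`: `u` has an absolutely continuous derivative `g` on `(0,1)` whose
derivative `u''` is square integrable. -/
def IsH2 (u : ℝ → ℝ) : Prop :=
  ∃ g : ℝ → ℝ, AbsolutelyContinuousOnInterval g 0 1 ∧
    (∀ x ∈ Ioo (0 : ℝ) 1, HasDerivAt u (g x) x) ∧
    MemLp (deriv g) 2 (volume.restrict (Ioo (0 : ℝ) 1))

/-- The `L^2(0,1)` norm. -/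
def l2Norm (g : ℝ → ℝ) : ℝ := √(∫ x in (0 : ℝ)..1, g x ^ 2)

/-! ## Bilinear forms -/

/-- The `L^2(0,1)` pairing `(f, v)`. -/
def l2 (f v : ℝ → ℝ) : ℝ := ∫ x in (0 : ℝ)..1, f x * v x

/-- `a₀(u, v) = (u', v')`. -/
def a0 (u v : ℝ → ℝ) : ℝ := l2 (deriv u) (deriv v)

/-- The energy norm `|u| = a₀(u, u)^(1/2)`. -/
def h1Norm (u : ℝ → ℝ) : ℝ := √(a0 u u)

/-- `b(v, u) = ε a₀(u, v) + (u', v)`. -/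
def b (ε : ℝ) (v u : ℝ → ℝ) : ℝ := ε * a0 u v + l2 (deriv u) v

/-- `u` is the weak solution of `-ε u'' + u' = f` on `(0,1)`, `u(0) = u(1) = 0`. -/
def IsWeakSolution (ε : ℝ) (f : ℝ → ℝ) (u : H10) : Prop :=
  ∀ v : H10, b ε v u = l2 f v

theorem int_mul {p q : ℝ → ℝ} (hp : MemLp p 2 (volume.restrict (Ioo (0 : ℝ) 1)))
    (hq : MemLp q 2 (volume.restrict (Ioo (0 : ℝ) 1))) :
    IntervalIntegrable (fun x => p x * q x) volume 0 1 := by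
  rw [intervalIntegrable_iff_integrableOn_Ioo_of_le zero_le_one]
  exact hp.integrable_mul hq

theorem l2_congr {p q r : ℝ → ℝ}
    (h : ∀ᵐ x ∂(volume.restrict (Ioo (0 : ℝ) 1)), p x = q x) : l2 p r = l2 q r := by
  unfold l2
  rw [intervalIntegral.integral_of_le zero_le_one, intervalIntegral.integral_of_le zero_le_one,
    integral_Ioc_eq_integral_Ioo, integral_Ioc_eq_integral_Ioo]
  refine integral_congr_ae ?_
  filter_upwards [h] with x hx
  rw [hx]

theorem a0_sub (u v w : H10) : a0 (u - v : H10) w = a0 u w - a0 v w := by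
  have h : a0 (u - v : H10) w = l2 (fun x => deriv u x - deriv v x) (deriv w) := by
    refine l2_congr ?_
    filter_upwards [ae_differentiableAt_Ioo u.2.1, ae_differentiableAt_Ioo v.2.1] with x h1 h2
    exact deriv_sub h1 h2
  rw [h]
  unfold a0 l2
  rw [← intervalIntegral.integral_sub (int_mul u.2.2.1 w.2.2.1) (int_mul v.2.2.1 w.2.2.1)]
  congr 1
  ext x
  ring

theorem eq_zero_of_a0 (u : H10) (h : a0 u u = 0) : u = 0 := by
  have hi := int_mul u.2.2.1 u.2.2.1
  rw [intervalIntegrable_iff_integrableOn_Ioo_of_le zero_le_one] at hi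
  unfold a0 l2 at h
  rw [intervalIntegral.integral_of_le zero_le_one, integral_Ioc_eq_integral_Ioo,
    integral_eq_zero_iff_of_nonneg (fun x => mul_self_nonneg _) hi] at h
  have hae : ∀ᵐ x, x ∈ Ioo (0 : ℝ) 1 → deriv (u : ℝ → ℝ) x = 0 := by
    rw [← ae_restrict_iff' measurableSet_Ioo]
    filter_upwards [h] with x hx
    simpa using hx
  ext x
  by_cases hx : x ∈ Ioo (0 : ℝ) 1
  · have hac : AbsolutelyContinuousOnInterval (u : ℝ → ℝ) 0 x := u.2.1.mono (by
      rw [uIcc_of_le zero_le_one, uIcc_of_le hx.1.le]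
      exact Icc_subset_Icc le_rfl hx.2.le)
    have h1 := hac.integral_deriv_eq_sub
    have h2 : ∫ t in (0 : ℝ)..x, deriv (u : ℝ → ℝ) t = ∫ t in (0 : ℝ)..x, (0 : ℝ) := by
      refine intervalIntegral.integral_congr_ae ?_
      filter_upwards [hae] with t ht htx
      rw [uIoc_of_le hx.1.le] at htx
      exact ht ⟨htx.1, htx.2.trans_lt hx.2⟩
    have h3 : (u : ℝ → ℝ) 0 = 0 := u.2.2.2 0 (by simp)
    rw [h2, h3] at h1
    simpa using h1.symm
  · simpa using u.2.2.2 x hx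

theorem eq_of_a0 (u v : H10) (h : a0 u (u - v : H10) = a0 v (u - v : H10)) : u = v := by
  have := a0_sub u v (u - v)
  rw [h, sub_self] at this
  exact sub_eq_zero.1 (eq_zero_of_a0 _ this)

/-! ## The operator `T` -/

theorem mem_H10_of_deriv {t g : ℝ → ℝ} (hac : AbsolutelyContinuousOnInterval t 0 1) (C : ℝ)
    (hC : ∀ x ∈ Ioo (0 : ℝ) 1, |g x| ≤ C)
    (hd : ∀ᵐ x ∂(volume.restrict (Ioo (0 : ℝ) 1)), deriv t x = g x)
    (h0 : ∀ x, x ∉ Ioo (0 : ℝ) 1 → t x = 0) : t ∈ H10 := by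
  refine ⟨hac, ?_, h0⟩
  refine MemLp.of_bound (measurable_deriv t).aestronglyMeasurable C ?_
  filter_upwards [hd, ae_restrict_mem measurableSet_Ioo] with x hx hm
  rw [hx, Real.norm_eq_abs]
  exact hC x hm

theorem existsUnique_T (u : H10) : ∃! t : H10, ∀ q : H10, a0 t q = l2 (deriv u) q := by
  have hIcc : uIcc (0 : ℝ) 1 = Icc 0 1 := uIcc_of_le zero_le_one
  have hcont : ContinuousOn (u : ℝ → ℝ) (Icc 0 1) := hIcc ▸ u.2.1.continuousOn
  have hint : IntervalIntegrable (u : ℝ → ℝ) volume 0 1 :=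
    ContinuousOn.intervalIntegrable (by rw [hIcc]; exact hcont)
  set m : ℝ := ∫ s in (0 : ℝ)..1, (u : ℝ → ℝ) s with hm
  let G : ℝ → ℝ := fun x => m * x - ∫ s in (0 : ℝ)..x, (u : ℝ → ℝ) s
  let t : ℝ → ℝ := (Ioo (0 : ℝ) 1).indicator G
  have hG : AbsolutelyContinuousOnInterval G 0 1 := by
    have h1 : AbsolutelyContinuousOnInterval (fun x : ℝ => x) 0 1 :=
      (LipschitzWith.id.lipschitzOnWith).absolutelyContinuousOnInterval
    exact (h1.const_mul m).sub
      (hint.absolutelyContinuousOnInterval_intervalIntegral (c := 0) (by simp))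
  have hGt : ∀ x ∈ uIcc (0 : ℝ) 1, G x = t x := by
    intro x hx
    rw [hIcc] at hx
    by_cases hx1 : x ∈ Ioo (0 : ℝ) 1
    · simp [t, hx1]
    · have : x = 0 ∨ x = 1 := by
        rcases hx.1.eq_or_lt with h | h
        · exact Or.inl h.symm
        · rcases hx.2.eq_or_lt with h' | h'
          · exact Or.inr h'
          · exact absurd ⟨h, h'⟩ hx1
      rcases this with rfl | rfl <;> simp [t, G, hm]
  have hder : ∀ x ∈ Ioo (0 : ℝ) 1, HasDerivAt t (m - (u : ℝ → ℝ) x) x := by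
    intro x hx
    have hnh : Ioo (0 : ℝ) 1 ∈ nhds x := isOpen_Ioo.mem_nhds hx
    have hca : ContinuousAt (u : ℝ → ℝ) x :=
      hcont.continuousAt (Icc_mem_nhds hx.1 hx.2)
    have hii : IntervalIntegrable (u : ℝ → ℝ) volume 0 x := hint.mono_set (by
      rw [hIcc, uIcc_of_le hx.1.le]; exact Icc_subset_Icc le_rfl hx.2.le)
    have hmeas : StronglyMeasurableAtFilter (u : ℝ → ℝ) (nhds x) volume :=
      ContinuousOn.stronglyMeasurableAtFilter isOpen_Ioo (hcont.mono Ioo_subset_Icc_self) x hx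
    have h1 := intervalIntegral.integral_hasDerivAt_right hii hmeas hca
    have h2 : HasDerivAt G (m - (u : ℝ → ℝ) x) x := by
      have h3 := (hasDerivAt_id x).const_mul m
      rw [mul_one] at h3
      exact h3.sub h1
    refine h2.congr_of_eventuallyEq ?_
    filter_upwards [hnh] with y hy
    simp [t, hy]
  have hac : AbsolutelyContinuousOnInterval t 0 1 := ac_congr hG hGt
  obtain ⟨C, hC⟩ := u.2.1.exists_bound
  have hdae : ∀ᵐ x ∂(volume.restrict (Ioo (0 : ℝ) 1)), deriv t x = m - (u : ℝ → ℝ) x := by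
    filter_upwards [ae_restrict_mem measurableSet_Ioo] with x hx
    exact (hder x hx).deriv
  have ht : t ∈ H10 := by
    refine mem_H10_of_deriv (g := fun x => m - (u : ℝ → ℝ) x) hac (|m| + C) ?_ hdae ?_
    · intro x hx
      have := hC x (by rw [hIcc]; exact Ioo_subset_Icc_self hx)
      rw [Real.norm_eq_abs] at this
      exact (abs_sub _ _).trans (by linarith)
    · intro x hx
      simp [t, hx]
  have key : ∀ q : H10, a0 t q = l2 (deriv u) q := by
    intro q
    have h1 : a0 t q = l2 (fun x => m - (u : ℝ → ℝ) x) (deriv q) := l2_congr hdae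
    have hq0 : (q : ℝ → ℝ) 0 = 0 := q.2.2.2 0 (by simp)
    have hq1 : (q : ℝ → ℝ) 1 = 0 := q.2.2.2 1 (by simp)
    have hibp := u.2.1.integral_mul_deriv_eq_deriv_mul q.2.1
    have hq := q.2.1.integral_deriv_eq_sub
    have hi1 : IntervalIntegrable (fun x => m * deriv (q : ℝ → ℝ) x) volume 0 1 :=
      q.2.1.intervalIntegrable_deriv.const_mul m
    have hi2 : IntervalIntegrable (fun x => (u : ℝ → ℝ) x * deriv (q : ℝ → ℝ) x) volume 0 1 :=
      q.2.1.intervalIntegrable_deriv.continuousOn_mul u.2.1.continuousOn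
    rw [h1]
    unfold l2
    have h2 : ∀ x, (m - (u : ℝ → ℝ) x) * deriv (q : ℝ → ℝ) x =
      m * deriv (q : ℝ → ℝ) x - (u : ℝ → ℝ) x * deriv (q : ℝ → ℝ) x := fun x => by ring
    simp_rw [h2]
    rw [intervalIntegral.integral_sub hi1 hi2, intervalIntegral.integral_const_mul, hq, hibp,
      hq0, hq1]
    ring
  refine ⟨⟨t, ht⟩, key, fun s hs => ?_⟩
  refine eq_of_a0 s ⟨t, ht⟩ ?_
  rw [hs]
  exact (key _).symm

/-- The operator `T : H^1_0 → H^1_0` defined by `a₀(T u, q) = (u', q)` for all `q`. -/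
def T (u : H10) : H10 := (existsUnique_T u).choose

/-! ## Finite element spaces on the uniform mesh with `n` subintervals -/

/-- The mesh size `h = 1/n`; the nodes are `j * h`, `0 ≤ j ≤ n`. -/
def mesh (n : ℕ) : ℝ := 1 / n

/-- The trial space `M_h` of continuous piecewise linear functions vanishing at `0` and `1`. -/
def trialSpace (n : ℕ) : Submodule ℝ H10 where
  carrier := {v | ∀ j : ℕ, j < n → ∃ α β : ℝ,
    ∀ x ∈ Icc (j * mesh n) ((j + 1) * mesh n), (v : ℝ → ℝ) x = α + β * x}
  add_mem' := by
    intro u v hu hv j hj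
    obtain ⟨α, β, h⟩ := hu j hj
    obtain ⟨α', β', h'⟩ := hv j hj
    refine ⟨α + α', β + β', fun x hx => ?_⟩
    have : ((u + v : H10) : ℝ → ℝ) x = (u : ℝ → ℝ) x + (v : ℝ → ℝ) x := rfl
    rw [this, h x hx, h' x hx]
    ring
  zero_mem' := fun j _ => ⟨0, 0, fun x _ => by simp⟩
  smul_mem' := by
    intro c u hu j hj
    obtain ⟨α, β, h⟩ := hu j hj
    refine ⟨c * α, c * β, fun x hx => ?_⟩
    have : ((c • u : H10) : ℝ → ℝ) x = c * (u : ℝ → ℝ) x := rfl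
    rw [this, h x hx]
    ring

/-- The nodal function `φ_j`: piecewise linear with `φ_j (i * h) = δ_ij`. -/
def hat (n : ℕ) (j : ℤ) (x : ℝ) : ℝ := max 0 (1 - |n * x - j|)

/-- The bubble `B_i = 4 φ_{i-1} φ_i`, supported in `[(i-1) h, i h]`. -/
def bubble (n : ℕ) (i : ℤ) (x : ℝ) : ℝ := 4 * hat n (i - 1) x * hat n i x

/-- The test function `φ_j + B_j - B_{j+1}`. -/
def testFun (n : ℕ) (j : ℤ) (x : ℝ) : ℝ := hat n j x + bubble n j x - bubble n (j + 1) x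

theorem hat_nonneg (n : ℕ) (j : ℤ) (x : ℝ) : 0 ≤ hat n j x := le_max_left _ _

theorem hat_le_one (n : ℕ) (j : ℤ) (x : ℝ) : hat n j x ≤ 1 :=
  max_le zero_le_one (by linarith [abs_nonneg (n * x - j)])

theorem hat_lip (n : ℕ) (j : ℤ) (x y : ℝ) : |hat n j x - hat n j y| ≤ n * |x - y| := by
  have h1 : |(1 - |n * x - j|) - (1 - |n * y - j|)| ≤ n * |x - y| := by
    have h2 : (1 - |n * x - j|) - (1 - |n * y - j|) = |n * y - j| - |n * x - j| := by ring
    rw [h2]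
    refine (abs_abs_sub_abs_le _ _).trans ?_
    have h3 : (n * y - j : ℝ) - (n * x - j) = n * (y - x) := by ring
    rw [h3, abs_mul, abs_sub_comm y x, abs_of_nonneg (Nat.cast_nonneg n)]
  unfold hat
  rw [max_comm 0, max_comm 0]
  exact (abs_max_sub_max_le_abs _ _ _).trans h1

theorem bubble_lip (n : ℕ) (j : ℤ) (x y : ℝ) :
    |bubble n j x - bubble n j y| ≤ 8 * n * |x - y| := by
  unfold bubble
  have h1 := hat_lip n (j - 1) x y
  have h2 := hat_lip n j x y
  have e : 4 * hat n (j - 1) x * hat n j x - 4 * hat n (j - 1) y * hat n j y =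
    4 * (hat n (j - 1) x * (hat n j x - hat n j y)) +
      4 * (hat n j y * (hat n (j - 1) x - hat n (j - 1) y)) := by ring
  rw [e]
  refine (abs_add_le _ _).trans ?_
  rw [abs_mul, abs_mul, abs_mul, abs_mul, abs_of_nonneg (hat_nonneg n (j - 1) x),
    abs_of_nonneg (hat_nonneg n j y), abs_of_nonneg (by norm_num : (0 : ℝ) ≤ 4)]
  have h3 : hat n (j - 1) x * |hat n j x - hat n j y| ≤ 1 * (n * |x - y|) :=
    mul_le_mul (hat_le_one _ _ _) h2 (abs_nonneg _) zero_le_one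
  have h4 : hat n j y * |hat n (j - 1) x - hat n (j - 1) y| ≤ 1 * (n * |x - y|) :=
    mul_le_mul (hat_le_one _ _ _) h1 (abs_nonneg _) zero_le_one
  linarith

theorem hat_eq_zero {n : ℕ} {j : ℕ} (h1 : 1 ≤ j) (h2 : j < n) (x : ℝ)
    (hx : x ∉ Ioo (0 : ℝ) 1) : hat n j x = 0 := by
  have hj : (1 : ℝ) ≤ j := by exact_mod_cast h1
  have hn : (j : ℝ) + 1 ≤ n := by exact_mod_cast h2
  have hn0 : (0 : ℝ) ≤ n := Nat.cast_nonneg n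
  unfold hat
  refine max_eq_left ?_
  rw [Int.cast_natCast]
  by_cases h0 : x ≤ 0
  · have : (n : ℝ) * x ≤ 0 := mul_nonpos_of_nonneg_of_nonpos hn0 h0
    have := neg_abs_le (n * x - j : ℝ)
    linarith
  · have h3 : 1 ≤ x := by
      by_contra h
      exact hx ⟨not_le.1 h0, not_le.1 h⟩
    have : (n : ℝ) ≤ n * x := le_mul_of_one_le_right hn0 h3
    have := le_abs_self (n * x - j : ℝ)
    linarith

theorem mem_H10_of_lip {t : ℝ → ℝ} (K : ℕ) (hK : ∀ x y, |t x - t y| ≤ K * |x - y|)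
    (h0 : ∀ x, x ∉ Ioo (0 : ℝ) 1 → t x = 0) : t ∈ H10 := by
  have hl : LipschitzWith K t := LipschitzWith.of_dist_le_mul fun x y => by
    simpa [Real.dist_eq] using hK x y
  refine mem_H10_of_deriv (g := deriv t) hl.lipschitzOnWith.absolutelyContinuousOnInterval K
    (fun x _ => ?_) (Filter.Eventually.of_forall fun _ => rfl) h0
  simpa using norm_deriv_le_of_lipschitz hl

theorem hat_mem {n j : ℕ} (h1 : 1 ≤ j) (h2 : j < n) : hat n j ∈ H10 :=
  mem_H10_of_lip n (hat_lip n j) (hat_eq_zero h1 h2)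

theorem testFun_mem {n j : ℕ} (h1 : 1 ≤ j) (h2 : j < n) : testFun n j ∈ H10 := by
  refine mem_H10_of_lip (17 * n) (fun x y => ?_) fun x hx => ?_
  · have a := hat_lip n j x y
    have b := bubble_lip n j x y
    have c := bubble_lip n (j + 1) x y
    rw [abs_le] at a b c ⊢
    unfold testFun
    push_cast
    constructor <;> linarith [a.1, a.2, b.1, b.2, c.1, c.2]
  · have h := hat_eq_zero h1 h2 x hx
    unfold testFun bubble
    rw [add_sub_cancel_right, h]
    ring

/-- The test space `V_h`, spanned by the functions `φ_j + B_j - B_{j+1}`, `1 ≤ j ≤ n - 1`. -/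
def testSpace (n : ℕ) : Submodule ℝ H10 :=
  Submodule.span ℝ {v | ∃ (j : ℕ) (h1 : 1 ≤ j) (h2 : j < n), v = ⟨testFun n j, testFun_mem h1 h2⟩}

theorem hat_mem_trialSpace {n j : ℕ} (h1 : 1 ≤ j) (h2 : j < n) :
    (⟨hat n j, hat_mem h1 h2⟩ : H10) ∈ trialSpace n := by
  intro i hi
  have hn : (0 : ℝ) < n := by exact_mod_cast (by omega : 0 < n)
  have hb : ∀ x ∈ Icc ((i : ℝ) * mesh n) ((i + 1) * mesh n), (i : ℝ) ≤ n * x ∧ n * x ≤ i + 1 := by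
    intro x hx
    unfold mesh at hx
    have e1 : (n : ℝ) * (i * (1 / n)) = i := by field_simp
    have e2 : (n : ℝ) * ((i + 1) * (1 / n)) = i + 1 := by field_simp
    exact ⟨by rw [← e1]; exact mul_le_mul_of_nonneg_left hx.1 hn.le,
      by rw [← e2]; exact mul_le_mul_of_nonneg_left hx.2 hn.le⟩
  rcases lt_trichotomy j i with h | h | h
  · have hc : (j : ℝ) + 1 ≤ i := by exact_mod_cast h
    refine ⟨0, 0, fun x hx => ?_⟩
    obtain ⟨ha, hb'⟩ := hb x hx
    simp only [hat, Int.cast_natCast]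
    rw [max_eq_left] <;> linarith [le_abs_self (n * x - j : ℝ)]
  · subst h
    refine ⟨1 + j, -n, fun x hx => ?_⟩
    obtain ⟨ha, hb'⟩ := hb x hx
    simp only [hat, Int.cast_natCast]
    rw [abs_of_nonneg (by linarith), max_eq_right (by linarith)]
    ring
  · rcases (Nat.succ_le_of_lt h).eq_or_lt with h' | h'
    · have hc : (j : ℝ) = i + 1 := by exact_mod_cast h'.symm
      refine ⟨1 - j, n, fun x hx => ?_⟩
      obtain ⟨ha, hb'⟩ := hb x hx
      simp only [hat, Int.cast_natCast]
      rw [abs_of_nonpos (by linarith), max_eq_right (by linarith)]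
      ring
    · have hc : (i : ℝ) + 1 + 1 ≤ j := by exact_mod_cast h'
      refine ⟨0, 0, fun x hx => ?_⟩
      obtain ⟨ha, hb'⟩ := hb x hx
      simp only [hat, Int.cast_natCast]
      rw [max_eq_left] <;> linarith [neg_abs_le (n * x - j : ℝ)]

theorem hat_node {n : ℕ} (hn : 0 < n) (i j : ℕ) :
    hat n j (i * mesh n) = if i = j then 1 else 0 := by
  have hn' : (n : ℝ) ≠ 0 := by exact_mod_cast hn.ne'
  have e : (n : ℝ) * (i * mesh n) = i := by unfold mesh; field_simp
  unfold hat
  rw [e, Int.cast_natCast]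
  split_ifs with h
  · subst h; simp
  · refine max_eq_left ?_
    rcases lt_or_gt_of_ne h with h | h
    · have : (i : ℝ) + 1 ≤ j := by exact_mod_cast h
      linarith [neg_abs_le (i - j : ℝ)]
    · have : (j : ℝ) + 1 ≤ i := by exact_mod_cast h
      linarith [le_abs_self (i - j : ℝ)]

theorem exists_interpolant {n : ℕ} (hn : 0 < n) (u : H10) :
    ∃ p ∈ trialSpace n, ∀ i : ℕ, i ≤ n →
      (p : ℝ → ℝ) (i * mesh n) = (u : ℝ → ℝ) (i * mesh n) := by
  let S : Finset ℕ := Finset.Ico 1 n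
  let φ : S → H10 := fun j => ⟨hat n (j : ℕ),
    hat_mem (Finset.mem_Ico.1 j.2).1 (Finset.mem_Ico.1 j.2).2⟩
  refine ⟨∑ j : S, (u : ℝ → ℝ) ((j : ℕ) * mesh n) • φ j, ?_, ?_⟩
  · exact Submodule.sum_mem _ fun j _ => Submodule.smul_mem _ _
      (hat_mem_trialSpace (Finset.mem_Ico.1 j.2).1 (Finset.mem_Ico.1 j.2).2)
  · intro i hi
    have e : ((∑ j : S, (u : ℝ → ℝ) ((j : ℕ) * mesh n) • φ j : H10) : ℝ → ℝ) (i * mesh n) =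
        ∑ j : S, (u : ℝ → ℝ) ((j : ℕ) * mesh n) * (if i = (j : ℕ) then 1 else 0) := by
      simp only [Submodule.coe_sum, Submodule.coe_smul, Finset.sum_apply, Pi.smul_apply,
        smul_eq_mul, φ, hat_node hn]
    rw [e]
    by_cases hS : i ∈ S
    · rw [Finset.sum_eq_single ⟨i, hS⟩]
      · simp
      · intro j _ hj
        rw [if_neg (fun h => hj (Subtype.ext h.symm)), mul_zero]
      · simp
    · rw [Finset.sum_eq_zero]
      · symm
        refine u.2.2.2 _ ?_
        have : i = 0 ∨ i = n := by
          simp only [S, Finset.mem_Ico] at hS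
          omega
        have hn' : (n : ℝ) ≠ 0 := by exact_mod_cast hn.ne'
        rcases this with rfl | rfl
        · simp
        · simp [mesh, hn']
      · intro j _
        rw [if_neg (fun h : i = (j : ℕ) => hS (h ▸ j.2)), mul_zero]

theorem a0_eq_zero_of_nodes {n : ℕ} (hn : 0 < n) (e w : H10) (hw : w ∈ trialSpace n)
    (he : ∀ i : ℕ, i ≤ n → (e : ℝ → ℝ) (i * mesh n) = 0) : a0 e w = 0 := by
  have hn' : (0 : ℝ) < n := by exact_mod_cast hn
  have hm : 0 < mesh n := by unfold mesh; positivity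
  have hmn : (n : ℝ) * mesh n = 1 := by unfold mesh; field_simp
  have hsub : ∀ k < n, uIcc ((k : ℝ) * mesh n) ((k + 1 : ℕ) * mesh n) ⊆ uIcc (0 : ℝ) 1 := by
    intro k hk
    have hk' : ((k + 1 : ℕ) : ℝ) ≤ n := by exact_mod_cast hk
    rw [uIcc_of_le zero_le_one, uIcc_of_le (by push_cast; nlinarith)]
    refine Icc_subset_Icc (by positivity) ?_
    rw [← hmn]
    exact mul_le_mul_of_nonneg_right hk' hm.le
  have hsum := intervalIntegral.sum_integral_adjacent_intervals (μ := volume) (n := n)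
    (a := fun k : ℕ => (k : ℝ) * mesh n)
    (f := fun x => deriv (e : ℝ → ℝ) x * deriv (w : ℝ → ℝ) x)
    (fun k hk => (int_mul e.2.2.1 w.2.2.1).mono_set (hsub k hk))
  simp only [Nat.cast_zero, zero_mul, hmn] at hsum
  unfold a0 l2
  rw [← hsum]
  refine Finset.sum_eq_zero fun k hk => ?_
  have hk := Finset.mem_range.1 hk
  obtain ⟨α, β, hab⟩ := hw k hk
  have hle : (k : ℝ) * mesh n ≤ (k + 1 : ℕ) * mesh n := by push_cast; nlinarith
  have h1 : ∫ x in (k : ℝ) * mesh n..(k + 1 : ℕ) * mesh n,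
      deriv (e : ℝ → ℝ) x * deriv (w : ℝ → ℝ) x =
      ∫ x in (k : ℝ) * mesh n..(k + 1 : ℕ) * mesh n, deriv (e : ℝ → ℝ) x * β := by
    rw [intervalIntegral.integral_of_le hle, intervalIntegral.integral_of_le hle,
      integral_Ioc_eq_integral_Ioo, integral_Ioc_eq_integral_Ioo]
    refine setIntegral_congr_fun measurableSet_Ioo fun x hx => ?_
    have hd : HasDerivAt (w : ℝ → ℝ) β x := by
      have h2 : HasDerivAt (fun y : ℝ => α + β * y) β x := by
        simpa using ((hasDerivAt_id x).const_mul β).const_add α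
      refine h2.congr_of_eventuallyEq ?_
      filter_upwards [isOpen_Ioo.mem_nhds hx] with y hy
      push_cast at hy
      exact hab y (Ioo_subset_Icc_self hy)
    simp only [hd.deriv]
  rw [h1, intervalIntegral.integral_mul_const,
    (e.2.1.mono (hsub k hk)).integral_deriv_eq_sub, he k hk.le, he (k + 1) hk]
  ring

theorem existsUnique_ellipticProj (n : ℕ) (u : H10) :
    ∃! p : H10, p ∈ trialSpace n ∧ ∀ w ∈ trialSpace n, a0 p w = a0 u w := by
  refine existsUnique_of_exists_of_unique ?_ ?_
  · rcases Nat.eq_zero_or_pos n with rfl | hn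
    · exact ⟨u, fun j hj => absurd hj (Nat.not_lt_zero j), fun _ _ => rfl⟩
    · obtain ⟨p, hp, hi⟩ := exists_interpolant hn u
      refine ⟨p, hp, fun w hw => ?_⟩
      have h := a0_eq_zero_of_nodes hn (p - u) w hw fun i hin => by
        have : ((p - u : H10) : ℝ → ℝ) (i * mesh n) =
          (p : ℝ → ℝ) (i * mesh n) - (u : ℝ → ℝ) (i * mesh n) := rfl
        rw [this, hi i hin, sub_self]
      rw [a0_sub] at h
      linarith
  · rintro p q ⟨hp, hp'⟩ ⟨hq, hq'⟩
    have hm := Submodule.sub_mem _ hp hq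
    exact eq_of_a0 p q ((hp' _ hm).trans (hq' _ hm).symm)

/-- The elliptic projection `P_h` onto `M_h`: `P_h u ∈ M_h` and `a₀(P_h u, w) = a₀(u, w)` for all
`w ∈ M_h`. -/
def ellipticProj (n : ℕ) (u : H10) : H10 := (existsUnique_ellipticProj n u).choose

/-- The discrete norm `‖u‖_{*,h}` on `H^1_0(0,1)`:
`‖u‖_{*,h}^2 = (3/19) ((ε + 2h/3)^2 |u|^2 + |P_h T u|^2)`. -/
def discNorm (ε : ℝ) (n : ℕ) (u : H10) : ℝ :=
  √(3 / 19 * ((ε + 2 * mesh n / 3) ^ 2 * h1Norm u ^ 2 + h1Norm (ellipticProj n (T u)) ^ 2))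

/-- `u_h ∈ M_h` solves the upwinding Petrov-Galerkin problem. -/
def IsPGSolution (ε : ℝ) (n : ℕ) (f : ℝ → ℝ) (uh : H10) : Prop :=
  uh ∈ trialSpace n ∧ ∀ v ∈ testSpace n, b ε v uh = l2 f v

end

end ConvDiff

open ConvDiff

namespace ConvDiff

/-! ## Calculus of the `L²` pairing -/

/-! Every test function is `v = w + bubbles`, where `w ∈ M_h` is piecewise linear and the bubble on
each element is scaled by the increment of `w`; conversely every `w ∈ M_h` occurs
(`exists_mem_testSpace_isBubbleEnrichment`). Reference-element integrals give `|v|² = (19/3)|w|²`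
and `(m', v - w) = (2h/3) a₀(m, w)` for `m ∈ M_h`, while `v - w` vanishes at the nodes and is
therefore `a₀`-orthogonal to `M_h`. Hence `b(v, m) = a₀(z, w)` with `z = (ε + 2h/3) m + P_h T m`
(`b_eq_a0`). Since `a₀(P_h T m, m) = (m', m) = 0`, Pythagoras turns `|z|` into `√(19/3) ‖m‖_{*,h}`,
and Cauchy-Schwarz, attained at `w = z`, gives (i).

For (ii), `u ↦ u_h` is a projection `Π` onto `M_h`, and `‖·‖_{*,h}` comes from an inner product on
`H^1_0`. The bound `‖Π y‖ ≤ √(19/3) ‖y‖` (`discNorm_le_of_forall_b_eq`) passes to `I - Π` because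
complementary oblique projections have equal norms (`complementary_projection_inequality`). This
gives quasi-optimality with the constant `√(19/3)` instead of `1 + √(19/3)`. To bound `Π`, split `y
= p + e` with `p` the nodal interpolant; `p` and `e` are `a₀`-orthogonal, and `e` meets the bubbles
only through their oscillation on each element. The remaining scalar estimate is
`stability_inequality`.

For (iii), insert the interpolant: its error `e` vanishes at the nodes, so `|P_h T e| ≤ ‖e‖_{L²} ≤
(h/2)|e|`, and Rolle's theorem gives `|e| ≤ h ‖u''‖`. -/

theorem memLp_coe (u : H10) : MemLp (u : ℝ → ℝ) 2 (volume.restrict (Ioo (0 : ℝ) 1)) := by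
  have hIcc : uIcc (0 : ℝ) 1 = Icc 0 1 := uIcc_of_le zero_le_one
  obtain ⟨C, hC⟩ := u.2.1.exists_bound
  have hc : ContinuousOn (u : ℝ → ℝ) (Ioo 0 1) :=
    (hIcc ▸ u.2.1.continuousOn).mono Ioo_subset_Icc_self
  refine MemLp.of_bound (hc.aestronglyMeasurable measurableSet_Ioo) C ?_
  filter_upwards [ae_restrict_mem measurableSet_Ioo] with x hx
  exact hC x (by rw [hIcc]; exact Ioo_subset_Icc_self hx)

theorem deriv_add_ae (u v : H10) : ∀ᵐ x ∂(volume.restrict (Ioo (0 : ℝ) 1)),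
    deriv ((u + v : H10) : ℝ → ℝ) x = deriv (u : ℝ → ℝ) x + deriv (v : ℝ → ℝ) x := by
  filter_upwards [ae_differentiableAt_Ioo u.2.1, ae_differentiableAt_Ioo v.2.1] with x h1 h2
  exact deriv_add h1 h2

theorem deriv_smul_ae (c : ℝ) (u : H10) : ∀ᵐ x ∂(volume.restrict (Ioo (0 : ℝ) 1)),
    deriv ((c • u : H10) : ℝ → ℝ) x = c * deriv (u : ℝ → ℝ) x := by
  filter_upwards [ae_differentiableAt_Ioo u.2.1] with x h1
  exact deriv_const_smul c h1

theorem l2_comm (p q : ℝ → ℝ) : l2 p q = l2 q p := by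
  unfold l2; congr 1; ext x; ring

theorem l2_self_nonneg (p : ℝ → ℝ) : 0 ≤ l2 p p :=
  intervalIntegral.integral_nonneg zero_le_one fun _ _ => mul_self_nonneg _

theorem l2_add {p q r : ℝ → ℝ} (hp : MemLp p 2 (volume.restrict (Ioo (0 : ℝ) 1)))
    (hq : MemLp q 2 (volume.restrict (Ioo (0 : ℝ) 1)))
    (hr : MemLp r 2 (volume.restrict (Ioo (0 : ℝ) 1))) :
    l2 (fun x => p x + q x) r = l2 p r + l2 q r := by
  unfold l2
  rw [← intervalIntegral.integral_add (int_mul hp hr) (int_mul hq hr)]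
  congr 1; ext x; ring

theorem l2_smul (c : ℝ) (p r : ℝ → ℝ) : l2 (fun x => c * p x) r = c * l2 p r := by
  unfold l2
  rw [← intervalIntegral.integral_const_mul]
  congr 1; ext x; ring

theorem l2_sq_le {p q : ℝ → ℝ} (hp : MemLp p 2 (volume.restrict (Ioo (0 : ℝ) 1)))
    (hq : MemLp q 2 (volume.restrict (Ioo (0 : ℝ) 1))) :
    l2 p q ^ 2 ≤ l2 p p * l2 q q := by
  have key : ∀ t : ℝ, 0 ≤ l2 q q * (t * t) + 2 * l2 p q * t + l2 p p := by
    intro t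
    have hq' := hq.const_mul t
    have h := l2_self_nonneg fun x => p x + t * q x
    have h1 := l2_add hp hq' (hp.add hq')
    have h2 := l2_add hp hq' hp
    have h3 := l2_add hp hq' hq
    have e1 := l2_smul t q fun x => p x + t * q x
    have e2 := l2_smul t q p
    have e3 := l2_smul t q q
    have c1 := l2_comm p fun x => p x + t * q x
    have c2 := l2_comm q fun x => p x + t * q x
    have c3 := l2_comm p q
    have h1' : l2 (fun x => p x + t * q x) (fun x => p x + t * q x) =
      l2 p (fun x => p x + t * q x) + l2 (fun x => t * q x) (fun x => p x + t * q x) := h1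
    rw [h1', e1, c1, c2, h2, h3, e2, e3, ← c3] at h
    linarith
  have := discrim_le_zero key
  unfold discrim at this
  linarith

theorem abs_l2_le {p q : ℝ → ℝ} (hp : MemLp p 2 (volume.restrict (Ioo (0 : ℝ) 1)))
    (hq : MemLp q 2 (volume.restrict (Ioo (0 : ℝ) 1))) :
    |l2 p q| ≤ √(l2 p p) * √(l2 q q) := by
  rw [← Real.sqrt_mul (l2_self_nonneg p)]
  exact Real.abs_le_sqrt (l2_sq_le hp hq)

/-! ## The energy inner product -/

theorem a0_comm (u v : ℝ → ℝ) : a0 u v = a0 v u := l2_comm _ _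

theorem a0_self_nonneg (u : ℝ → ℝ) : 0 ≤ a0 u u := l2_self_nonneg _

theorem a0_add (u v w : H10) : a0 (u + v : H10) w = a0 u w + a0 v w :=
  (l2_congr (deriv_add_ae u v)).trans (l2_add u.2.2.1 v.2.2.1 w.2.2.1)

theorem a0_smul (c : ℝ) (u w : H10) : a0 (c • u : H10) w = c * a0 u w :=
  (l2_congr (deriv_smul_ae c u)).trans (l2_smul _ _ _)

theorem a0_add_right (u v w : H10) : a0 w (u + v : H10) = a0 w u + a0 w v := by
  rw [a0_comm, a0_add, a0_comm u, a0_comm v]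

theorem a0_smul_right (c : ℝ) (u w : H10) : a0 w (c • u : H10) = c * a0 w u := by
  rw [a0_comm, a0_smul, a0_comm u]

theorem h1Norm_nonneg (u : ℝ → ℝ) : 0 ≤ h1Norm u := Real.sqrt_nonneg _

theorem h1Norm_sq (u : ℝ → ℝ) : h1Norm u ^ 2 = a0 u u := Real.sq_sqrt (a0_self_nonneg u)

theorem abs_a0_le (u v : H10) : |a0 u v| ≤ h1Norm u * h1Norm v := abs_l2_le u.2.2.1 v.2.2.1

theorem l2_deriv_add (u v : H10) {r : ℝ → ℝ}
    (hr : MemLp r 2 (volume.restrict (Ioo (0 : ℝ) 1))) :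
    l2 (deriv ((u + v : H10) : ℝ → ℝ)) r = l2 (deriv u) r + l2 (deriv v) r :=
  (l2_congr (deriv_add_ae u v)).trans (l2_add u.2.2.1 v.2.2.1 hr)

theorem l2_deriv_smul (c : ℝ) (u : H10) (r : ℝ → ℝ) :
    l2 (deriv ((c • u : H10) : ℝ → ℝ)) r = c * l2 (deriv u) r :=
  (l2_congr (deriv_smul_ae c u)).trans (l2_smul _ _ _)

theorem b_add (ε : ℝ) (v u w : H10) : b ε v (u + w : H10) = b ε v u + b ε v w := by
  unfold b
  rw [a0_add, l2_deriv_add u w (memLp_coe v)]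
  ring

theorem b_smul (ε c : ℝ) (v u : H10) : b ε v (c • u : H10) = c * b ε v u := by
  unfold b
  rw [a0_smul, l2_deriv_smul]
  ring

theorem l2_deriv_eq_neg (u v : H10) : l2 (deriv u) v = -l2 u (deriv v) := by
  have h := u.2.1.integral_mul_deriv_eq_deriv_mul v.2.1
  rw [v.2.2.2 0 (by simp), v.2.2.2 1 (by simp)] at h
  unfold l2
  rw [h]
  ring

theorem l2_deriv_self (u : H10) : l2 (deriv u) u = 0 := by
  have h := l2_deriv_eq_neg u u
  rw [l2_comm (u : ℝ → ℝ)] at h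
  linarith

/-! ## The operator `P_h T` -/

theorem a0_T (u q : H10) : a0 (T u) q = l2 (deriv u) q := (existsUnique_T u).choose_spec.1 q

theorem ellipticProj_mem (n : ℕ) (u : H10) : ellipticProj n u ∈ trialSpace n :=
  (existsUnique_ellipticProj n u).choose_spec.1.1

theorem a0_ellipticProj (n : ℕ) (u : H10) {w : H10} (hw : w ∈ trialSpace n) :
    a0 (ellipticProj n u) w = a0 u w :=
  (existsUnique_ellipticProj n u).choose_spec.1.2 w hw

/-- The composition `P_h T`. -/
noncomputable def projT (n : ℕ) (u : H10) : H10 := ellipticProj n (T u)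

theorem projT_mem (n : ℕ) (u : H10) : projT n u ∈ trialSpace n := ellipticProj_mem n _

theorem a0_projT {n : ℕ} (u : H10) {w : H10} (hw : w ∈ trialSpace n) :
    a0 (projT n u) w = l2 (deriv u) w :=
  (a0_ellipticProj n _ hw).trans (a0_T u w)

theorem projT_eq {n : ℕ} {u s : H10} (hs : s ∈ trialSpace n)
    (h : ∀ w ∈ trialSpace n, a0 s w = l2 (deriv u) w) : projT n u = s := by
  have hm := Submodule.sub_mem _ (projT_mem n u) hs
  exact eq_of_a0 _ _ ((a0_projT u hm).trans (h _ hm).symm)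

theorem projT_add (n : ℕ) (u v : H10) : projT n (u + v) = projT n u + projT n v := by
  refine projT_eq (Submodule.add_mem _ (projT_mem n u) (projT_mem n v)) fun w hw => ?_
  rw [a0_add, a0_projT u hw, a0_projT v hw, l2_deriv_add u v (memLp_coe w)]

theorem projT_smul (n : ℕ) (c : ℝ) (u : H10) : projT n (c • u) = c • projT n u := by
  refine projT_eq (Submodule.smul_mem _ _ (projT_mem n u)) fun w hw => ?_
  rw [a0_smul, a0_projT u hw, l2_deriv_smul]

/-- Skew-symmetry of `(u', v)`; this removes the cross term from `|c m + P_h T m|²`. -/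
theorem a0_projT_self {n : ℕ} {u : H10} (hu : u ∈ trialSpace n) : a0 (projT n u) u = 0 := by
  rw [a0_projT u hu, l2_deriv_self]

/-- Test with `P_h T u` itself and move the derivative off `u`: `P_h T` costs only an `L²` norm,
which is one power of `h` better for functions vanishing at the nodes. -/
theorem h1Norm_projT_le (n : ℕ) (u : H10) : h1Norm (projT n u) ≤ √(l2 u u) := by
  have h : h1Norm (projT n u) ^ 2 ≤ √(l2 u u) * h1Norm (projT n u) := by
    rw [h1Norm_sq, a0_projT u (projT_mem n u), l2_deriv_eq_neg]
    exact (neg_le_abs _).trans (abs_l2_le (memLp_coe u) (projT n u).2.2.1)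
  rcases (h1Norm_nonneg (projT n u)).eq_or_lt with h0 | h0
  · rw [← h0]; exact Real.sqrt_nonneg _
  · rw [sq] at h
    exact le_of_mul_le_mul_right h h0

/-! ## Elementwise integration -/

theorem mesh_pos {n : ℕ} (hn : 0 < n) : 0 < mesh n := by unfold mesh; positivity

theorem nat_mul_mesh {n : ℕ} (hn : 0 < n) : (n : ℝ) * mesh n = 1 := by unfold mesh; field_simp

theorem element_subset {n k : ℕ} (hk : k < n) :
    Icc ((k : ℝ) * mesh n) ((k + 1) * mesh n) ⊆ Icc 0 1 := by
  have hm := mesh_pos (Nat.zero_lt_of_lt hk)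
  have h : (k : ℝ) + 1 ≤ n := by exact_mod_cast hk
  refine Icc_subset_Icc (by positivity) ?_
  have := mul_le_mul_of_nonneg_right h hm.le
  rwa [nat_mul_mesh (Nat.zero_lt_of_lt hk)] at this

theorem element_Ioo_subset {n k : ℕ} (hk : k < n) :
    Ioo ((k : ℝ) * mesh n) ((k + 1) * mesh n) ⊆ Ioo 0 1 := by
  have h := interior_mono (element_subset hk)
  rwa [interior_Icc, interior_Icc] at h

theorem element_le {n k : ℕ} (hk : k < n) : (k : ℝ) * mesh n ≤ (k + 1) * mesh n := by
  have hm := mesh_pos (Nat.zero_lt_of_lt hk)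
  nlinarith

theorem element_uIcc_subset {n k : ℕ} (hk : k < n) :
    uIcc ((k : ℝ) * mesh n) ((k + 1) * mesh n) ⊆ uIcc 0 1 := by
  rw [uIcc_of_le (element_le hk), uIcc_of_le zero_le_one]
  exact element_subset hk

theorem integral_eq_sum_elements {n : ℕ} (hn : 0 < n) {F : ℝ → ℝ}
    (hF : IntervalIntegrable F volume 0 1) :
    ∫ x in (0 : ℝ)..1, F x =
      ∑ k ∈ Finset.range n, ∫ x in ((k : ℝ) * mesh n)..((k + 1) * mesh n), F x := by
  have h := intervalIntegral.sum_integral_adjacent_intervals (μ := volume) (n := n)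
    (a := fun k : ℕ => (k : ℝ) * mesh n) (f := F)
    (fun k hk => hF.mono_set (by push_cast; exact element_uIcc_subset hk))
  simp only [Nat.cast_zero, zero_mul, nat_mul_mesh hn, Nat.cast_add, Nat.cast_one] at h
  exact h.symm

theorem integral_element_comp {n : ℕ} (hn : 0 < n) (k : ℕ) (φ : ℝ → ℝ) :
    ∫ x in ((k : ℝ) * mesh n)..((k + 1) * mesh n), φ (n * x - k) =
      mesh n * ∫ t in (0 : ℝ)..1, φ t := by
  have hn' : (n : ℝ) ≠ 0 := by exact_mod_cast hn.ne'
  rw [intervalIntegral.integral_comp_mul_sub φ hn']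
  have e1 : (n : ℝ) * (k * mesh n) - k = 0 := by unfold mesh; field_simp; ring
  have e2 : (n : ℝ) * ((k + 1) * mesh n) - k = 1 := by unfold mesh; field_simp; ring
  rw [e1, e2, smul_eq_mul, mesh, one_div]

/-- Scaling to the reference element: if the shape `φ` is the same on every element and only the
amplitude `σ` varies, the integral of `φ` over `[0,1]` factors out of the sum. -/
theorem integral_eq_of_elementwise {n : ℕ} (hn : 0 < n) {F H : ℝ → ℝ} (φ : ℝ → ℝ)
    (hF : IntervalIntegrable F volume 0 1) (hH : IntervalIntegrable H volume 0 1)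
    (h : ∀ k < n, ∃ σ : ℝ, ∀ x ∈ Ioo ((k : ℝ) * mesh n) ((k + 1) * mesh n),
      F x = σ * φ (n * x - k) ∧ H x = σ) :
    ∫ x in (0 : ℝ)..1, F x = (∫ t in (0 : ℝ)..1, φ t) * ∫ x in (0 : ℝ)..1, H x := by
  rw [integral_eq_sum_elements hn hF, integral_eq_sum_elements hn hH, Finset.mul_sum]
  refine Finset.sum_congr rfl fun k hk => ?_
  have hk := Finset.mem_range.1 hk
  obtain ⟨σ, hσ⟩ := h k hk
  have h1 : ∫ x in ((k : ℝ) * mesh n)..((k + 1) * mesh n), F x =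
      ∫ x in ((k : ℝ) * mesh n)..((k + 1) * mesh n), σ * φ (n * x - k) := by
    rw [intervalIntegral.integral_of_le (element_le hk),
      intervalIntegral.integral_of_le (element_le hk),
      integral_Ioc_eq_integral_Ioo, integral_Ioc_eq_integral_Ioo]
    exact setIntegral_congr_fun measurableSet_Ioo fun x hx => (hσ x hx).1
  have h2 : ∫ x in ((k : ℝ) * mesh n)..((k + 1) * mesh n), H x =
      ∫ x in ((k : ℝ) * mesh n)..((k + 1) * mesh n), σ := by
    rw [intervalIntegral.integral_of_le (element_le hk),
      intervalIntegral.integral_of_le (element_le hk),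
      integral_Ioc_eq_integral_Ioo, integral_Ioc_eq_integral_Ioo]
    exact setIntegral_congr_fun measurableSet_Ioo fun x hx => (hσ x hx).2
  rw [h1, h2, intervalIntegral.integral_const_mul, integral_element_comp hn,
    intervalIntegral.integral_const, smul_eq_mul]
  ring

theorem integral_le_of_elementwise {n : ℕ} (hn : 0 < n) {F H : ℝ → ℝ} (C : ℝ)
    (hF : IntervalIntegrable F volume 0 1) (hH : IntervalIntegrable H volume 0 1)
    (h : ∀ k < n, ∀ x ∈ Ioo ((k : ℝ) * mesh n) ((k + 1) * mesh n),
      F x ≤ C * ∫ y in ((k : ℝ) * mesh n)..((k + 1) * mesh n), H y) :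
    ∫ x in (0 : ℝ)..1, F x ≤ C * mesh n * ∫ x in (0 : ℝ)..1, H x := by
  rw [integral_eq_sum_elements hn hF, integral_eq_sum_elements hn hH, Finset.mul_sum]
  refine Finset.sum_le_sum fun k hk => ?_
  have hk := Finset.mem_range.1 hk
  have h1 := intervalIntegral.integral_mono_on_of_le_Ioo (element_le hk)
    (hF.mono_set (element_uIcc_subset hk)) intervalIntegrable_const (h k hk)
  rw [intervalIntegral.integral_const, smul_eq_mul] at h1
  refine h1.trans_eq ?_
  ring

/-- The integral of the squared deviation of `φ` from its mean is nonnegative. -/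
theorem sq_integral_le {a c : ℝ} (hac : a ≤ c) {φ : ℝ → ℝ}
    (h1 : IntervalIntegrable φ volume a c)
    (h2 : IntervalIntegrable (fun x => φ x * φ x) volume a c) :
    (∫ x in a..c, φ x) ^ 2 ≤ (c - a) * ∫ x in a..c, φ x * φ x := by
  rcases hac.eq_or_lt with rfl | hlt
  · simp
  set I := ∫ x in a..c, φ x
  have hd : 0 < c - a := sub_pos.2 hlt
  have h3 : 0 ≤ ∫ x in a..c, (φ x - I / (c - a)) * (φ x - I / (c - a)) :=
    intervalIntegral.integral_nonneg hac fun _ _ => mul_self_nonneg _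
  have e : ∀ x, (φ x - I / (c - a)) * (φ x - I / (c - a)) =
      φ x * φ x - 2 * (I / (c - a)) * φ x + (I / (c - a)) ^ 2 := fun x => by ring
  simp_rw [e] at h3
  rw [intervalIntegral.integral_add (h2.sub (h1.const_mul _)) intervalIntegrable_const,
    intervalIntegral.integral_sub h2 (h1.const_mul _), intervalIntegral.integral_const_mul,
    intervalIntegral.integral_const, smul_eq_mul] at h3
  have h4 : (c - a) * ((∫ x in a..c, φ x * φ x) - 2 * (I / (c - a)) * I +
      (c - a) * (I / (c - a)) ^ 2) = (c - a) * (∫ x in a..c, φ x * φ x) - I ^ 2 := by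
    field_simp; ring
  have := mul_nonneg hd.le h3
  rw [h4] at this
  linarith

theorem sq_sub_le_integral_deriv {g : ℝ → ℝ} (hg : AbsolutelyContinuousOnInterval g 0 1)
    (hg' : MemLp (deriv g) 2 (volume.restrict (Ioo (0 : ℝ) 1))) {a c : ℝ} (h0 : 0 ≤ a)
    (hac : a ≤ c) (h1 : c ≤ 1) :
    (g c - g a) ^ 2 ≤ (c - a) * ∫ x in a..c, deriv g x * deriv g x := by
  have hs : uIcc a c ⊆ uIcc 0 1 := by
    rw [uIcc_of_le hac, uIcc_of_le zero_le_one]; exact Icc_subset_Icc h0 h1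
  rw [← (hg.mono hs).integral_deriv_eq_sub]
  exact sq_integral_le hac (hg.mono hs).intervalIntegrable_deriv ((int_mul hg' hg').mono_set hs)

/-! ## Test functions and their piecewise linear parts -/

theorem local_coord_mem {n k : ℕ} (hn : 0 < n) {x : ℝ}
    (hx : x ∈ Icc ((k : ℝ) * mesh n) ((k + 1) * mesh n)) : (n * x - k : ℝ) ∈ Icc (0 : ℝ) 1 := by
  have hn' : (0 : ℝ) ≤ n := n.cast_nonneg
  have h1 := mul_le_mul_of_nonneg_left hx.1 hn'
  have h2 := mul_le_mul_of_nonneg_left hx.2 hn'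
  have e1 : (n : ℝ) * (k * mesh n) = k := by
    rw [mul_left_comm, nat_mul_mesh hn, mul_one]
  have e2 : (n : ℝ) * ((k + 1) * mesh n) = k + 1 := by
    rw [mul_left_comm, nat_mul_mesh hn, mul_one]
  rw [e1] at h1
  rw [e2] at h2
  constructor <;> linarith

theorem hat_eq_on_element {n k : ℕ} (i : ℤ) {x : ℝ} (hx : (n * x - k : ℝ) ∈ Icc (0 : ℝ) 1) :
    hat n i x = if i = k then 1 - (n * x - k) else if i = k + 1 then n * x - k else 0 := by
  obtain ⟨h0, h1⟩ := hx
  unfold hat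
  split_ifs with h h'
  · rw [h, Int.cast_natCast, abs_of_nonneg h0, max_eq_right (by linarith)]
  · rw [h']
    push_cast
    rw [abs_of_nonpos (by linarith), max_eq_right (by linarith)]
    ring
  · refine max_eq_left ?_
    rcases lt_or_gt_of_ne h with hl | hl
    · have : (i : ℝ) + 1 ≤ k := by exact_mod_cast hl
      linarith [le_abs_self (n * x - i : ℝ)]
    · have : (k : ℝ) + 2 ≤ i := by
        have : (k : ℤ) + 2 ≤ i := by omega
        exact_mod_cast this
      linarith [neg_abs_le (n * x - i : ℝ)]

/-- `v` arises from the piecewise linear function `w` by adding, on every element, the bubble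
whose height is the increment of `w`. -/
def IsBubbleEnrichment (n : ℕ) (w v : H10) : Prop :=
  ∀ k < n, ∃ α β : ℝ, ∀ x ∈ Icc ((k : ℝ) * mesh n) ((k + 1) * mesh n),
    (w : ℝ → ℝ) x = α + β * x ∧
      (v : ℝ → ℝ) x = α + β * x + β * mesh n * (4 * (n * x - k) * (1 - (n * x - k)))

theorem IsBubbleEnrichment.mem_trialSpace {n : ℕ} {w v : H10} (h : IsBubbleEnrichment n w v) :
    w ∈ trialSpace n := fun k hk => by
  obtain ⟨α, β, H⟩ := h k hk
  exact ⟨α, β, fun x hx => (H x hx).1⟩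

theorem isBubbleEnrichment_zero (n : ℕ) : IsBubbleEnrichment n 0 0 :=
  fun _ _ => ⟨0, 0, fun x _ => by simp⟩

theorem IsBubbleEnrichment.add {n : ℕ} {w v w' v' : H10} (h : IsBubbleEnrichment n w v)
    (h' : IsBubbleEnrichment n w' v') : IsBubbleEnrichment n (w + w') (v + v') := by
  intro k hk
  obtain ⟨α, β, H⟩ := h k hk
  obtain ⟨α', β', H'⟩ := h' k hk
  refine ⟨α + α', β + β', fun x hx => ?_⟩
  have e1 : ((w + w' : H10) : ℝ → ℝ) x = (w : ℝ → ℝ) x + (w' : ℝ → ℝ) x := rfl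
  have e2 : ((v + v' : H10) : ℝ → ℝ) x = (v : ℝ → ℝ) x + (v' : ℝ → ℝ) x := rfl
  rw [e1, e2, (H x hx).1, (H x hx).2, (H' x hx).1, (H' x hx).2]
  constructor <;> ring

theorem IsBubbleEnrichment.smul {n : ℕ} {w v : H10} (h : IsBubbleEnrichment n w v) (c : ℝ) :
    IsBubbleEnrichment n (c • w) (c • v) := by
  intro k hk
  obtain ⟨α, β, H⟩ := h k hk
  refine ⟨c * α, c * β, fun x hx => ?_⟩
  have e1 : ((c • w : H10) : ℝ → ℝ) x = c * (w : ℝ → ℝ) x := rfl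
  have e2 : ((c • v : H10) : ℝ → ℝ) x = c * (v : ℝ → ℝ) x := rfl
  rw [e1, e2, (H x hx).1, (H x hx).2]
  constructor <;> ring

/-- The hat `φ_j` rises by 1 on the element carrying `B_j` and falls by 1 on the one carrying
`B_{j+1}`, which explains the signs in `φ_j + B_j - B_{j+1}`. -/
theorem isBubbleEnrichment_testFun {n j : ℕ} (h1 : 1 ≤ j) (h2 : j < n) :
    IsBubbleEnrichment n ⟨hat n j, hat_mem h1 h2⟩ ⟨testFun n j, testFun_mem h1 h2⟩ := by
  intro k hk
  have hn : 0 < n := Nat.zero_lt_of_lt hk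
  have hm := nat_mul_mesh hn
  rcases eq_or_ne j k with rfl | hjk
  · refine ⟨1 + j, -n, fun x hx => ?_⟩
    have ht := local_coord_mem hn hx
    simp only [testFun, bubble, hat_eq_on_element _ ht]
    have a1 : ¬((j : ℤ) - 1 = j + 1) := by omega
    simp [a1]
    constructor
    · ring
    linear_combination (4 * (n * x - j) * (1 - (n * x - j))) * hm
  · rcases eq_or_ne j (k + 1) with rfl | hjk'
    · refine ⟨-k, n, fun x hx => ?_⟩
      have ht := local_coord_mem hn hx
      simp only [testFun, bubble, hat_eq_on_element _ ht]
      have a1 : ¬((k : ℤ) + 1 + 1 = k) := by omega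
      simp [a1]
      constructor
      · ring
      · linear_combination -(4 * (n * x - k) * (1 - (n * x - k))) * hm
    · refine ⟨0, 0, fun x hx => ?_⟩
      have ht := local_coord_mem hn hx
      have a1 : (j : ℤ) ≠ k := by omega
      have a2 : (j : ℤ) ≠ k + 1 := by omega
      simp only [testFun, bubble, hat_eq_on_element _ ht]
      simp [a1, a2]

theorem exists_isBubbleEnrichment_of_mem_testSpace {n : ℕ} {v : H10} (hv : v ∈ testSpace n) :
    ∃ w, IsBubbleEnrichment n w v := by
  induction hv using Submodule.span_induction with
  | mem v hv =>
    obtain ⟨j, h1, h2, rfl⟩ := hv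
    exact ⟨_, isBubbleEnrichment_testFun h1 h2⟩
  | zero => exact ⟨0, isBubbleEnrichment_zero n⟩
  | add v v' _ _ h h' =>
    obtain ⟨w, hw⟩ := h
    obtain ⟨w', hw'⟩ := h'
    exact ⟨_, hw.add hw'⟩
  | smul c v _ h =>
    obtain ⟨w, hw⟩ := h
    exact ⟨_, hw.smul c⟩

theorem eq_of_nodes {n : ℕ} (hn : 0 < n) {w w' : H10} (hw : w ∈ trialSpace n)
    (hw' : w' ∈ trialSpace n)
    (h : ∀ i : ℕ, i ≤ n → (w : ℝ → ℝ) (i * mesh n) = (w' : ℝ → ℝ) (i * mesh n)) : w = w' :=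
  sub_eq_zero.1 (eq_zero_of_a0 _ (a0_eq_zero_of_nodes hn _ _ (Submodule.sub_mem _ hw hw')
    fun i hi => sub_eq_zero.2 (h i hi)))

theorem exists_mem_testSpace_isBubbleEnrichment {n : ℕ} (hn : 0 < n) {w : H10}
    (hw : w ∈ trialSpace n) : ∃ v ∈ testSpace n, IsBubbleEnrichment n w v := by
  -- The same coefficients are used on the hats and on the test functions, so the enrichment
  -- relation is carried through the sum; prescribing the nodal values of `w` then recovers `w`.
  have key : ∀ (S : Finset ℕ) (c : ℕ → ℝ), (∀ j ∈ S, 1 ≤ j ∧ j < n) →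
      ∃ p, (∃ v ∈ testSpace n, IsBubbleEnrichment n p v) ∧ ∀ i : ℕ,
        (p : ℝ → ℝ) (i * mesh n) = if i ∈ S then c i else 0 := by
    intro S c
    induction S using Finset.induction_on with
    | empty => exact fun _ => ⟨0, ⟨0, Submodule.zero_mem _, isBubbleEnrichment_zero n⟩, by simp⟩
    | insert j S hj ih =>
      intro hS
      obtain ⟨p, ⟨v, hv, hpv⟩, hp⟩ := ih fun i hi => hS i (Finset.mem_insert_of_mem hi)
      obtain ⟨h1, h2⟩ := hS j (Finset.mem_insert_self j S)
      refine ⟨p + c j • ⟨hat n j, hat_mem h1 h2⟩, ⟨v + c j • ⟨testFun n j, testFun_mem h1 h2⟩,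
        Submodule.add_mem _ hv (Submodule.smul_mem _ _ (Submodule.subset_span ⟨j, h1, h2, rfl⟩)),
        hpv.add ((isBubbleEnrichment_testFun h1 h2).smul _)⟩, fun i => ?_⟩
      have e : ((p + c j • ⟨hat n j, hat_mem h1 h2⟩ : H10) : ℝ → ℝ) (i * mesh n) =
        (p : ℝ → ℝ) (i * mesh n) + c j * hat n j (i * mesh n) := rfl
      rw [e, hp, hat_node hn]
      rcases eq_or_ne i j with rfl | hij
      · simp [hj]
      · simp [hij]
  obtain ⟨p, ⟨v, hv, hpv⟩, hp⟩ := key (Finset.Ico 1 n) (fun i => (w : ℝ → ℝ) (i * mesh n))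
    fun j hj => Finset.mem_Ico.1 hj
  refine ⟨v, hv, ?_⟩
  have : p = w := by
    refine eq_of_nodes hn hpv.mem_trialSpace hw fun i hi => ?_
    rw [hp]
    split_ifs with hi'
    · rfl
    · symm
      refine w.2.2.2 _ ?_
      rw [Finset.mem_Ico] at hi'
      have : i = 0 ∨ i = n := by omega
      rcases this with rfl | rfl
      · simp
      · simp [nat_mul_mesh hn]
  rwa [← this]

theorem IsBubbleEnrichment.deriv_eq {n : ℕ} {w v : H10} (h : IsBubbleEnrichment n w v) {k : ℕ}
    (hk : k < n) : ∃ β : ℝ, ∀ x ∈ Ioo ((k : ℝ) * mesh n) ((k + 1) * mesh n),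
      deriv (w : ℝ → ℝ) x = β ∧ deriv (v : ℝ → ℝ) x = β + β * (4 * (1 - 2 * (n * x - k))) ∧
      (v : ℝ → ℝ) x - (w : ℝ → ℝ) x = β * mesh n * (4 * (n * x - k) * (1 - (n * x - k))) := by
  obtain ⟨α, β, H⟩ := h k hk
  have hm := nat_mul_mesh (Nat.zero_lt_of_lt hk)
  refine ⟨β, fun x hx => ⟨?_, ?_, ?_⟩⟩
  · have h2 : HasDerivAt (fun y : ℝ => α + β * y) β x := by
      simpa using ((hasDerivAt_id x).const_mul β).const_add α
    refine (h2.congr_of_eventuallyEq ?_).deriv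
    filter_upwards [isOpen_Ioo.mem_nhds hx] with y hy using (H y (Ioo_subset_Icc_self hy)).1
  · have h1 : HasDerivAt (fun y : ℝ => (n * y - k : ℝ)) n x := by
      simpa using ((hasDerivAt_id x).const_mul (n : ℝ)).sub_const (k : ℝ)
    have h2 : HasDerivAt (fun y : ℝ => α + β * y) β x := by
      simpa using ((hasDerivAt_id x).const_mul β).const_add α
    have h3 := h2.add (((h1.const_mul 4).mul (h1.const_sub 1)).const_mul (β * mesh n))
    have h4 : HasDerivAt (v : ℝ → ℝ) _ x := h3.congr_of_eventuallyEq (by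
      filter_upwards [isOpen_Ioo.mem_nhds hx] with y hy using (H y (Ioo_subset_Icc_self hy)).2)
    rw [h4.deriv]
    linear_combination (β * (4 * (1 - 2 * (n * x - k)))) * hm
  · obtain ⟨e1, e2⟩ := H x (Ioo_subset_Icc_self hx)
    rw [e1, e2]
    ring

theorem deriv_eq_of_mem_trialSpace {n : ℕ} {w : H10} (hw : w ∈ trialSpace n) {k : ℕ}
    (hk : k < n) : ∃ β : ℝ, ∀ x ∈ Ioo ((k : ℝ) * mesh n) ((k + 1) * mesh n),
      deriv (w : ℝ → ℝ) x = β := by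
  obtain ⟨v, -, hv⟩ := exists_mem_testSpace_isBubbleEnrichment (Nat.zero_lt_of_lt hk) hw
  obtain ⟨β, hβ⟩ := hv.deriv_eq hk
  exact ⟨β, fun x hx => (hβ x hx).1⟩

theorem IsBubbleEnrichment.nodes {n : ℕ} (hn : 0 < n) {w v : H10} (h : IsBubbleEnrichment n w v)
    (i : ℕ) (hi : i ≤ n) : ((v - w : H10) : ℝ → ℝ) (i * mesh n) = 0 := by
  rcases hi.eq_or_lt with rfl | hi
  · exact (v - w).2.2.2 _ (by simp [nat_mul_mesh hn])
  · obtain ⟨α, β, H⟩ := h i hi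
    obtain ⟨h1, h2⟩ := H (i * mesh n) ⟨le_rfl, element_le hi⟩
    have e : ((v - w : H10) : ℝ → ℝ) (i * mesh n) =
      (v : ℝ → ℝ) (i * mesh n) - (w : ℝ → ℝ) (i * mesh n) := rfl
    have e2 : (n : ℝ) * (i * mesh n) = i := by rw [mul_left_comm, nat_mul_mesh hn, mul_one]
    rw [e, h1, h2, e2]
    ring

/-! ### Reference-element integrals: the constants `19/3` and `2h/3`. -/

theorem integral_quartic (p q r s u : ℝ) :
    ∫ t in (0 : ℝ)..1, (p + q * t + r * t ^ 2 + s * t ^ 3 + u * t ^ 4) =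
      p + q / 2 + r / 3 + s / 4 + u / 5 := by
  have h : ∀ t : ℝ, HasDerivAt
      (fun t : ℝ => p * t + q * (t ^ 2 / 2) + r * (t ^ 3 / 3) + s * (t ^ 4 / 4) + u * (t ^ 5 / 5))
      (p + q * t + r * t ^ 2 + s * t ^ 3 + u * t ^ 4) t := by
    intro t
    have h := (((((hasDerivAt_id t).const_mul p).add
      (((hasDerivAt_pow 2 t).div_const 2).const_mul q)).add
      (((hasDerivAt_pow 3 t).div_const 3).const_mul r)).add
      (((hasDerivAt_pow 4 t).div_const 4).const_mul s)).add
      (((hasDerivAt_pow 5 t).div_const 5).const_mul u)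
    refine h.congr_deriv ?_
    norm_num
  rw [intervalIntegral.integral_eq_sub_of_hasDerivAt (fun t _ => h t)
    (Continuous.intervalIntegrable (by fun_prop) _ _)]
  ring

theorem IsBubbleEnrichment.a0_self {n : ℕ} (hn : 0 < n) {w v : H10}
    (h : IsBubbleEnrichment n w v) : a0 v v = 19 / 3 * a0 w w := by
  have := integral_eq_of_elementwise hn (fun t => (1 + 4 * (1 - 2 * t)) ^ 2)
    (int_mul v.2.2.1 v.2.2.1) (int_mul w.2.2.1 w.2.2.1) fun k hk => by
      obtain ⟨β, hβ⟩ := h.deriv_eq hk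
      refine ⟨β * β, fun x hx => ?_⟩
      obtain ⟨h1, h2, -⟩ := hβ x hx
      rw [h1, h2]
      exact ⟨by ring, rfl⟩
  unfold a0 l2
  rw [this]
  congr 1
  -- The enriched slope is `β (5 - 8t)`, and `25 - 40 + 64/3 = 19/3`.
  have e := integral_quartic 25 (-80) 64 0 0
  calc _ = ∫ t in (0 : ℝ)..1, (25 + (-80) * t + 64 * t ^ 2 + 0 * t ^ 3 + 0 * t ^ 4) := by
        congr 1; ext t; ring
    _ = _ := by rw [e]; norm_num

theorem IsBubbleEnrichment.h1Norm_eq {n : ℕ} (hn : 0 < n) {w v : H10}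
    (h : IsBubbleEnrichment n w v) : h1Norm v = √(19 / 3) * h1Norm w := by
  unfold h1Norm
  rw [h.a0_self hn, Real.sqrt_mul (by norm_num)]

/-- The mean `2/3` of `4t(1 - t)` becomes the artificial diffusion `2h/3`: this is the upwinding
effect. -/
theorem IsBubbleEnrichment.l2_deriv_sub {n : ℕ} (hn : 0 < n) {w v m : H10}
    (h : IsBubbleEnrichment n w v) (hm : m ∈ trialSpace n) :
    l2 (deriv m) (v - w : H10) = 2 * mesh n / 3 * a0 m w := by
  have := integral_eq_of_elementwise hn (fun t => mesh n * (4 * t * (1 - t)))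
    (int_mul m.2.2.1 (memLp_coe (v - w))) (int_mul m.2.2.1 w.2.2.1) fun k hk => by
      obtain ⟨β, hβ⟩ := h.deriv_eq hk
      obtain ⟨μ, hμ⟩ := deriv_eq_of_mem_trialSpace hm hk
      refine ⟨μ * β, fun x hx => ?_⟩
      obtain ⟨h1, -, h2⟩ := hβ x hx
      have e : ((v - w : H10) : ℝ → ℝ) x = (v : ℝ → ℝ) x - (w : ℝ → ℝ) x := rfl
      rw [h1, e, h2, hμ x hx]
      exact ⟨by ring, rfl⟩
  unfold a0 l2
  rw [this]
  congr 1
  have e := integral_quartic 0 (4 * mesh n) (-4 * mesh n) 0 0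
  calc _ = ∫ t in (0 : ℝ)..1,
          (0 + (4 * mesh n) * t + (-4 * mesh n) * t ^ 2 + 0 * t ^ 3 + 0 * t ^ 4) := by
        congr 1; ext t; ring
    _ = _ := by rw [e]; ring

/-! ## The discrete optimal trial norm -/

theorem discNorm_eq (ε : ℝ) (n : ℕ) (u : H10) :
    discNorm ε n u =
      √(3 / 19 * ((ε + 2 * mesh n / 3) ^ 2 * a0 u u + a0 (projT n u) (projT n u))) := by
  unfold discNorm
  rw [h1Norm_sq, h1Norm_sq]
  rfl

theorem discNorm_nonneg (ε : ℝ) (n : ℕ) (u : H10) : 0 ≤ discNorm ε n u := Real.sqrt_nonneg _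

theorem discNorm_sq (ε : ℝ) (n : ℕ) (u : H10) :
    discNorm ε n u ^ 2 =
      3 / 19 * ((ε + 2 * mesh n / 3) ^ 2 * a0 u u + a0 (projT n u) (projT n u)) := by
  rw [discNorm_eq, Real.sq_sqrt]
  have := a0_self_nonneg (u : ℝ → ℝ)
  have := a0_self_nonneg (projT n u : ℝ → ℝ)
  positivity

theorem b_eq_a0 (ε : ℝ) {n : ℕ} (hn : 0 < n) {w v m : H10} (h : IsBubbleEnrichment n w v)
    (hm : m ∈ trialSpace n) :
    b ε v m = a0 ((ε + 2 * mesh n / 3) • m + projT n m : H10) w := by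
  have h1 : a0 (v - w : H10) m = 0 := a0_eq_zero_of_nodes hn _ _ hm fun i hi => h.nodes hn i hi
  rw [a0_sub, a0_comm v, a0_comm w] at h1
  have h2 : l2 (deriv m) v = l2 (deriv m) w + l2 (deriv m) (v - w : H10) := by
    have := l2_add (memLp_coe w) (memLp_coe (v - w)) m.2.2.1
    rw [l2_comm, l2_comm (deriv (m : ℝ → ℝ)) w, l2_comm (deriv (m : ℝ → ℝ)) (v - w : H10), ← this]
    congr 1
    ext x
    exact (add_sub_cancel ((w : ℝ → ℝ) x) ((v : ℝ → ℝ) x)).symm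
  unfold b
  rw [a0_add, a0_smul, a0_projT m h.mem_trialSpace, h2, h.l2_deriv_sub hn hm]
  linear_combination ε * h1

theorem discNorm_eq_of_mem_trialSpace (ε : ℝ) {n : ℕ} {m : H10}
    (hm : m ∈ trialSpace n) :
    h1Norm ((ε + 2 * mesh n / 3) • m + projT n m : H10) = √(19 / 3) * discNorm ε n m := by
  have h := a0_projT_self hm
  rw [discNorm_eq, ← Real.sqrt_mul (by norm_num), h1Norm]
  congr 1
  rw [a0_add, a0_smul, a0_add_right, a0_add_right, a0_smul_right, a0_smul_right,
    a0_comm m (projT n m),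
    h]
  ring

theorem isLUB_discNorm (ε : ℝ) {n : ℕ} (hn : 0 < n) {m : H10} (hm : m ∈ trialSpace n) :
    IsLUB {r : ℝ | ∃ v ∈ testSpace n, r = b ε v m / h1Norm v} (discNorm ε n m) := by
  have hs : (0 : ℝ) < √(19 / 3) := by positivity
  have hss : √(19 / 3 : ℝ) * √(19 / 3) = 19 / 3 := Real.mul_self_sqrt (by norm_num)
  set z : H10 := (ε + 2 * mesh n / 3) • m + projT n m with hz
  have hzn : h1Norm z = √(19 / 3) * discNorm ε n m := discNorm_eq_of_mem_trialSpace ε hm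
  have hzm : z ∈ trialSpace n :=
    Submodule.add_mem _ (Submodule.smul_mem _ _ hm) (projT_mem n m)
  refine IsGreatest.isLUB ⟨?_, ?_⟩
  -- The supremum is attained at the enrichment of `z`. If the norm is 0, the quotient is `0 / 0 =
  -- 0`.
  · obtain ⟨v, hv, hzv⟩ := exists_mem_testSpace_isBubbleEnrichment hn hzm
    refine ⟨v, hv, ?_⟩
    rw [b_eq_a0 ε hn hzv hm, ← hz, ← h1Norm_sq, hzv.h1Norm_eq hn, hzn]
    rcases (discNorm_nonneg ε n m).eq_or_lt with h0 | h0
    · rw [← h0]; simp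
    · field_simp
  · rintro r ⟨v, hv, rfl⟩
    obtain ⟨w, hw⟩ := exists_isBubbleEnrichment_of_mem_testSpace hv
    refine div_le_of_le_mul₀ (h1Norm_nonneg _) (discNorm_nonneg _ _ _) ?_
    rw [b_eq_a0 ε hn hw hm, hw.h1Norm_eq hn, ← hz]
    refine (le_abs_self _).trans ((abs_a0_le _ _).trans_eq ?_)
    rw [hzn]
    ring

/-! ## Functions vanishing at the nodes -/

/-- Estimate `e(x)²` from both endpoints and average with weights `c - x` and `x - a`; the factor
`1/4` is `(x - a)(c - x) ≤ (c - a)²/4`. -/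
theorem sq_le_of_eq_zero {e : H10} {a c x : ℝ} (h0 : 0 ≤ a) (hax : a ≤ x) (hxc : x ≤ c)
    (h1 : c ≤ 1) (ha : (e : ℝ → ℝ) a = 0) (hc : (e : ℝ → ℝ) c = 0) :
    (e : ℝ → ℝ) x ^ 2 ≤
      (c - a) / 4 * ∫ y in a..c, deriv (e : ℝ → ℝ) y * deriv (e : ℝ → ℝ) y := by
  have i1 := sq_sub_le_integral_deriv e.2.1 e.2.2.1 h0 hax (hxc.trans h1)
  have i2 := sq_sub_le_integral_deriv e.2.1 e.2.2.1 (h0.trans hax) hxc h1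
  rw [ha, sub_zero] at i1
  rw [hc, zero_sub, neg_sq] at i2
  have hint : ∀ p q : ℝ, 0 ≤ p → p ≤ q → q ≤ 1 →
      IntervalIntegrable (fun y => deriv (e : ℝ → ℝ) y * deriv (e : ℝ → ℝ) y) volume p q :=
    fun p q h h' h'' => (int_mul e.2.2.1 e.2.2.1).mono_set (by
      rw [uIcc_of_le h', uIcc_of_le zero_le_one]; exact Icc_subset_Icc h h'')
  have hJ : 0 ≤ ∫ y in a..c, deriv (e : ℝ → ℝ) y * deriv (e : ℝ → ℝ) y :=
    intervalIntegral.integral_nonneg (hax.trans hxc) fun _ _ => mul_self_nonneg _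
  rw [← intervalIntegral.integral_add_adjacent_intervals (hint a x h0 hax (hxc.trans h1))
    (hint x c (h0.trans hax) hxc h1)] at hJ ⊢
  set I := ∫ y in a..x, deriv (e : ℝ → ℝ) y * deriv (e : ℝ → ℝ) y
  set J := ∫ y in x..c, deriv (e : ℝ → ℝ) y * deriv (e : ℝ → ℝ) y
  rcases (hax.trans hxc).eq_or_lt with hac | hac
  · have : x = a := le_antisymm (hac ▸ hxc) hax
    rw [← hac, this, ha]
    simp
  · have hd : 0 < c - a := sub_pos.2 hac
    refine le_of_mul_le_mul_left ?_ hd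
    have j1 := mul_le_mul_of_nonneg_left i1 (sub_nonneg.2 hxc)
    have j2 := mul_le_mul_of_nonneg_left i2 (sub_nonneg.2 hax)
    nlinarith [mul_nonneg (sq_nonneg ((x - a) - (c - x))) hJ]

theorem l2_self_le_of_nodes {n : ℕ} (hn : 0 < n) {e : H10}
    (he : ∀ i : ℕ, i ≤ n → (e : ℝ → ℝ) (i * mesh n) = 0) :
    l2 e e ≤ (mesh n / 2) ^ 2 * a0 e e := by
  have := integral_le_of_elementwise hn (mesh n / 4) (int_mul (memLp_coe e) (memLp_coe e))
    (int_mul e.2.2.1 e.2.2.1) fun k hk x hx => by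
      have h := element_subset hk
      have h1 := (h ⟨le_rfl, element_le hk⟩).1
      have h2 := (h ⟨element_le hk, le_rfl⟩).2
      have hk' := he (k + 1) hk
      push_cast at hk'
      have := sq_le_of_eq_zero h1 hx.1.le hx.2.le h2 (he k hk.le) hk'
      rw [← sq]
      refine this.trans_eq ?_
      ring
  refine this.trans_eq ?_
  unfold a0 l2
  ring

theorem sqrt_l2_self_le_of_nodes {n : ℕ} (hn : 0 < n) {e : H10}
    (he : ∀ i : ℕ, i ≤ n → (e : ℝ → ℝ) (i * mesh n) = 0) :
    √(l2 e e) ≤ mesh n / 2 * h1Norm e := by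
  have hm := mesh_pos hn
  refine (Real.sqrt_le_sqrt (l2_self_le_of_nodes hn he)).trans_eq ?_
  rw [Real.sqrt_mul (sq_nonneg _), Real.sqrt_sq (by positivity)]
  rfl

theorem abs_l2_deriv_le_of_nodes {n : ℕ} (hn : 0 < n) {e : H10}
    (he : ∀ i : ℕ, i ≤ n → (e : ℝ → ℝ) (i * mesh n) = 0) (p : H10) :
    |l2 (deriv e) p| ≤ mesh n / 2 * h1Norm e * h1Norm p := by
  rw [l2_deriv_eq_neg, abs_neg]
  exact (abs_l2_le (memLp_coe e) p.2.2.1).trans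
    (mul_le_mul_of_nonneg_right (sqrt_l2_self_le_of_nodes hn he) (h1Norm_nonneg _))

/-- On functions vanishing at the nodes the bubbles contribute to `b` at most this much. -/
theorem abs_b_sub_l2_le_of_nodes (ε : ℝ) {n : ℕ} (hn : 0 < n) {w v e : H10}
    (h : IsBubbleEnrichment n w v) (he : ∀ i : ℕ, i ≤ n → (e : ℝ → ℝ) (i * mesh n) = 0) :
    |b ε v e - l2 (deriv e) w| ≤
      √(16 / 3 * ε ^ 2 + 4 / 45 * mesh n ^ 2) * h1Norm w * h1Norm e := by
  -- Since `e'` has mean zero on each element, multiples of the elementwise constant `w'` may be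
  -- subtracted for free. The factor `ε + 2h/3` is chosen to remove the elementwise mean of `ε v' +
  -- (v - w)`.
  set G : ℝ → ℝ := fun x => ε * deriv (v : ℝ → ℝ) x +
    ((v - w : H10) : ℝ → ℝ) x + (-(ε + 2 * mesh n / 3)) * deriv (w : ℝ → ℝ) x with hG
  have m1 := v.2.2.1.const_mul ε
  have m2 := memLp_coe (v - w)
  have m3 := w.2.2.1.const_mul (-(ε + 2 * mesh n / 3))
  have m12 := m1.add m2
  have mG : MemLp G 2 (volume.restrict (Ioo (0 : ℝ) 1)) := m12.add m3
  have hew : a0 e w = 0 := a0_eq_zero_of_nodes hn e w h.mem_trialSpace he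
  have e1 : l2 G (deriv e) = b ε v e - l2 (deriv e) w := by
    have s1 : l2 G (deriv e) = _ := l2_add m12 m3 e.2.2.1
    have s2 : l2 (fun x => ε * deriv (v : ℝ → ℝ) x + ((v - w : H10) : ℝ → ℝ) x) (deriv e) = _ :=
      l2_add m1 m2 e.2.2.1
    have s3 : l2 v (deriv e) = l2 w (deriv e) + l2 (v - w : H10) (deriv e) := by
      rw [← l2_add (memLp_coe w) m2 e.2.2.1]
      congr 1
      ext x
      exact (add_sub_cancel ((w : ℝ → ℝ) x) ((v : ℝ → ℝ) x)).symm
    have s4 : l2 (deriv w) (deriv e) = 0 := (l2_comm _ _).trans hew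
    have s5 : a0 e v = l2 (deriv v) (deriv e) := l2_comm _ _
    rw [l2_smul, s4] at s1
    rw [l2_smul] at s2
    refine s1.trans ?_
    unfold b
    rw [l2_comm (deriv (e : ℝ → ℝ)) v, l2_comm (deriv (e : ℝ → ℝ)) w, s3, s5]
    refine (congrArg (· + -(ε + 2 * mesh n / 3) * 0) s2).trans ?_
    ring
  -- On an element `G` is `β` times `4ε(1 - 2t) + h(4t(1 - t) - 2/3)`. The two terms are odd and
  -- even about `t = 1/2`, so no cross term survives; their mean squares are `16ε²/3` and `4h²/45`.
  have e2 : l2 G G = (16 / 3 * ε ^ 2 + 4 / 45 * mesh n ^ 2) * a0 w w := by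
    have := integral_eq_of_elementwise hn
      (fun t => (4 * ε * (1 - 2 * t) + mesh n * (4 * t * (1 - t) - 2 / 3)) ^ 2)
      (int_mul mG mG) (int_mul w.2.2.1 w.2.2.1) fun k hk => by
        obtain ⟨β, hβ⟩ := h.deriv_eq hk
        refine ⟨β * β, fun x hx => ?_⟩
        obtain ⟨h1, h2, h3⟩ := hβ x hx
        have e : ((v - w : H10) : ℝ → ℝ) x = (v : ℝ → ℝ) x - (w : ℝ → ℝ) x := rfl
        simp only [hG]
        rw [h1, h2, e, h3]
        exact ⟨by ring, rfl⟩
    unfold a0 l2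
    rw [this]
    congr 1
    have e := integral_quartic ((4 * ε - 2 / 3 * mesh n) ^ 2)
      (2 * (4 * ε - 2 / 3 * mesh n) * (4 * mesh n - 8 * ε))
      ((4 * mesh n - 8 * ε) ^ 2 - 8 * mesh n * (4 * ε - 2 / 3 * mesh n))
      (-8 * mesh n * (4 * mesh n - 8 * ε)) (16 * mesh n ^ 2)
    refine Eq.trans ?_ (e.trans (by ring))
    congr 1; ext t; ring
  rw [← e1]
  refine (abs_l2_le mG e.2.2.1).trans_eq ?_
  rw [e2, Real.sqrt_mul (by positivity)]
  rfl

/-! ## Stability and quasi-optimality -/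

theorem quadratic_form_nonneg {A B C : ℝ} (hA : 0 < A) (h : B ^ 2 ≤ 4 * A * C) (x y : ℝ) :
    0 ≤ A * x ^ 2 - B * (x * y) + C * y ^ 2 := by
  have h1 : 0 ≤ 4 * A * (A * x ^ 2 - B * (x * y) + C * y ^ 2) := by
    have h2 := mul_nonneg (sub_nonneg.2 h) (sq_nonneg y)
    nlinarith [sq_nonneg (2 * A * x - B * y)]
  exact nonneg_of_mul_nonneg_right h1 (by positivity)

theorem stability_inequality {ε h c a E R X : ℝ} (hε : 0 < ε) (hh : 0 < h) (ha : 0 ≤ a)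
    (hE : 0 ≤ E) (hc : c ^ 2 = 16 / 3 * ε ^ 2 + 4 / 45 * h ^ 2)
    (hX : X ^ 2 ≤ a ^ 2 + R ^ 2 + h * (a * E)) :
    (X + c * E) ^ 2 ≤ 19 / 3 * (a ^ 2 + (ε + 2 * h / 3) ^ 2 * E ^ 2 + R ^ 2) := by
  -- The weight `l` of the Cauchy-Schwarz step `k1` must reduce to `ε` at `h = 0`, where `l² + c²`
  -- equals `(19/3) l²` and nothing is lost. The slack in `e1` and `e2` is then divisible by `h`,
  -- matching the cross term `h a E` that it has to absorb.
  set l : ℝ := ε + h / 3 with hl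
  have hlp : 0 < l := by positivity
  have hεh := mul_pos hε hh
  have hh2 := mul_pos hh hh
  have k1 : l ^ 2 * (X + c * E) ^ 2 ≤ (l ^ 2 + c ^ 2) * (X ^ 2 + l ^ 2 * E ^ 2) := by
    nlinarith [sq_nonneg (c * X - l ^ 2 * E)]
  have k2 : (l ^ 2 + c ^ 2) * (X ^ 2 + l ^ 2 * E ^ 2) ≤
      (l ^ 2 + c ^ 2) * (a ^ 2 + R ^ 2 + h * (a * E) + l ^ 2 * E ^ 2) :=
    mul_le_mul_of_nonneg_left (by linarith) (by positivity)
  have k3 : l ^ 2 + c ^ 2 ≤ 19 / 3 * l ^ 2 := by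
    rw [hc, hl]; nlinarith
  -- The cross term is absorbed by the `a²` and `E²` slack, divided by `h`; what remains is a
  -- discriminant condition, checked coefficientwise in `ε` and `h`.
  have k4 : 0 ≤ (32 / 9 * ε + 68 / 135 * h) * a ^ 2 - 19 / 3 * l ^ 2 * (a * E) +
      l ^ 2 * (70 / 9 * ε + 353 / 135 * h) * E ^ 2 := by
    refine quadratic_form_nonneg (by positivity) ?_ a E
    have : (19 / 3) ^ 2 * l ^ 2 ≤
        4 * (32 / 9 * ε + 68 / 135 * h) * (70 / 9 * ε + 353 / 135 * h) := by
      rw [hl]; nlinarith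
    have := mul_le_mul_of_nonneg_left this (sq_nonneg l)
    linarith
  have k5 := mul_nonneg hh.le k4
  have k6 := mul_le_mul_of_nonneg_right k3 (mul_nonneg hh.le (mul_nonneg ha hE))
  have k7 := mul_le_mul_of_nonneg_right k3 (sq_nonneg R)
  refine le_of_mul_le_mul_left ?_ (pow_pos hlp 2)
  refine k1.trans (k2.trans ?_)
  have e1 : 19 / 3 * l ^ 2 - (l ^ 2 + c ^ 2) = h * (32 / 9 * ε + 68 / 135 * h) := by
    rw [hc, hl]; ring
  have e2 : 19 / 3 * (ε + 2 * h / 3) ^ 2 - (l ^ 2 + c ^ 2) =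
      h * (70 / 9 * ε + 353 / 135 * h) := by
    rw [hc, hl]; ring
  have e3 := congrArg (· * a ^ 2) e1
  have e4 := congrArg (· * (l ^ 2 * E ^ 2)) e2
  linarith

/-- Stability of the Petrov-Galerkin projection on all of `H^1_0`, with `m` in the role of `Π y`.
The test function is the enrichment of `w = (ε + 2h/3) m + P_h T m`, for which `b(v, m) = |w|²`. -/
theorem discNorm_le_of_forall_b_eq {ε : ℝ} {n : ℕ} (hε : 0 < ε) (hn : 0 < n) {y m : H10}
    (hm : m ∈ trialSpace n) (h : ∀ v ∈ testSpace n, b ε v y = b ε v m) :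
    discNorm ε n m ≤ √(19 / 3) * discNorm ε n y := by
  have hmesh := mesh_pos hn
  set c' : ℝ := ε + 2 * mesh n / 3 with hc'
  have hc'0 : 0 < c' := by positivity
  obtain ⟨p, hp, hpy⟩ := exists_interpolant hn y
  set e : H10 := y - p with he
  have hnodes : ∀ i : ℕ, i ≤ n → (e : ℝ → ℝ) (i * mesh n) = 0 :=
    fun i hi => sub_eq_zero.2 (hpy i hi).symm
  have hy : y = p + e := (add_sub_cancel p y).symm
  set w : H10 := c' • m + projT n m with hw
  have hwm : w ∈ trialSpace n :=
    Submodule.add_mem _ (Submodule.smul_mem _ _ hm) (projT_mem n m)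
  obtain ⟨v, hv, hwv⟩ := exists_mem_testSpace_isBubbleEnrichment hn hwm
  set x : H10 := c' • p + projT n y with hx
  set c : ℝ := √(16 / 3 * ε ^ 2 + 4 / 45 * mesh n ^ 2) with hc
  have hcsq : c ^ 2 = 16 / 3 * ε ^ 2 + 4 / 45 * mesh n ^ 2 := Real.sq_sqrt (by positivity)
  have hW0 := h1Norm_nonneg (w : ℝ → ℝ)
  have hW : h1Norm w ≤ h1Norm x + c * h1Norm e := by
    have h1 : h1Norm w ^ 2 = b ε v y := by
      rw [h v hv, b_eq_a0 ε hn hwv hm, h1Norm_sq]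
    have h2 : b ε v y = a0 x w + (b ε v e - l2 (deriv e) w) := by
      rw [hy, b_add, b_eq_a0 ε hn hwv hp, hx, a0_add, a0_add, a0_projT p hwm, a0_projT y hwm, hy,
        l2_deriv_add p e (memLp_coe w)]
      ring
    have h3 := (le_abs_self _).trans (abs_a0_le x w)
    have h4 := (le_abs_self _).trans (abs_b_sub_l2_le_of_nodes ε hn hwv hnodes)
    rcases hW0.eq_or_lt with h0 | h0
    · rw [← h0]
      have := h1Norm_nonneg (x : ℝ → ℝ)
      have := h1Norm_nonneg (e : ℝ → ℝ)
      positivity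
    · refine le_of_mul_le_mul_right ?_ h0
      rw [← sq, h1, h2]
      refine (add_le_add h3 h4).trans_eq ?_
      ring
  have hX : h1Norm x ^ 2 ≤ (c' * h1Norm p) ^ 2 + h1Norm (projT n y) ^ 2 +
      mesh n * (c' * h1Norm p * h1Norm e) := by
    -- Only `e` contributes, because `(p', p) = 0`; hence the cross term carries a factor `h`.
    have h1 : a0 (projT n y) p ≤ mesh n / 2 * h1Norm e * h1Norm p := by
      rw [a0_projT y hp, hy, l2_deriv_add p e (memLp_coe p), l2_deriv_self, zero_add]
      exact (le_abs_self _).trans (abs_l2_deriv_le_of_nodes hn hnodes p)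
    have h2 := mul_le_mul_of_nonneg_left h1 hc'0.le
    rw [mul_pow, h1Norm_sq, h1Norm_sq, h1Norm_sq, hx, a0_add, a0_add_right, a0_add_right, a0_smul,
      a0_smul, a0_smul_right, a0_smul_right, a0_comm p (projT n y)]
    linarith
  have hP : a0 y y = h1Norm p ^ 2 + h1Norm e ^ 2 := by
    have h1 : a0 e p = 0 := a0_eq_zero_of_nodes hn e p hp hnodes
    rw [hy, a0_add, a0_add_right, a0_add_right, a0_comm p e, h1, h1Norm_sq, h1Norm_sq]
    ring
  have key := stability_inequality hε hmesh (mul_nonneg hc'0.le (h1Norm_nonneg (p : ℝ → ℝ)))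
    (h1Norm_nonneg (e : ℝ → ℝ)) hcsq hX
  have hWsq := pow_le_pow_left₀ hW0 hW 2
  rw [hw, hc', discNorm_eq_of_mem_trialSpace ε hm] at hWsq
  have hyn := discNorm_sq ε n y
  rw [← h1Norm_sq (projT n y : ℝ → ℝ), hP] at hyn
  have hs : √(19 / 3 : ℝ) ^ 2 = 19 / 3 := Real.sq_sqrt (by norm_num)
  refine (sq_le_sq₀ (discNorm_nonneg ε n m)
    (mul_nonneg (Real.sqrt_nonneg _) (discNorm_nonneg ε n y))).1 ?_
  rw [mul_pow, hs] at hWsq ⊢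
  rw [hyn]
  have := hWsq.trans key
  rw [← hc'] at this ⊢
  linarith

/-- Complementary oblique projections in an inner product space have the same norm, in terms of
`A = ‖a‖²`, `M = ‖m‖²` and `D = ⟪a, m⟫` for `a` in the kernel and `m` in the range. -/
theorem complementary_projection_inequality {A M D K : ℝ} (hA : 0 ≤ A) (hM : 0 ≤ M) (hK : 1 ≤ K)
    (h : ∀ t : ℝ, M ≤ K * (M + 2 * t * D + t ^ 2 * A)) :
    A ≤ K * (M + 2 * D + A) := by
  rcases hA.eq_or_lt with rfl | hA
  · have := h 1
    linarith
  -- The minimizing `t = -D/A` gives a bound symmetric in `A` and `M`, so range and kernel can be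
  -- exchanged.
  have h1 : A * M ≤ K * (A * M - D ^ 2) := by
    have h2 := mul_le_mul_of_nonneg_left (h (-D / A)) hA.le
    refine h2.trans_eq ?_
    field_simp
    ring
  rcases hM.eq_or_lt with rfl | hM
  · have h2 : D ^ 2 = 0 := by nlinarith [sq_nonneg D]
    rw [pow_eq_zero_iff two_ne_zero] at h2
    rw [h2]
    nlinarith
  · refine le_of_mul_le_mul_right ?_ hM
    -- `M (M + 2D + A) = (A M - D²) + (M + D)²`.
    have := mul_nonneg (zero_le_one.trans hK) (sq_nonneg (M + D))
    linarith

theorem discNorm_sq_add_smul (ε : ℝ) (n : ℕ) (m a : H10) (t : ℝ) :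
    discNorm ε n (m + t • a) ^ 2 = discNorm ε n m ^ 2 +
      2 * t * (3 / 19 * ((ε + 2 * mesh n / 3) ^ 2 * a0 m a + a0 (projT n m) (projT n a))) +
      t ^ 2 * discNorm ε n a ^ 2 := by
  simp only [discNorm_sq, projT_add, projT_smul, a0_add, a0_add_right, a0_smul, a0_smul_right]
  rw [a0_comm a m, a0_comm (projT n a) (projT n m)]
  ring

/-- Here `u - p = (u_h - p) + (u - u_h)` splits into range and kernel of `Π`: the first summand lies
in `M_h`, and `b(v, ·)` annihilates the second by Galerkin orthogonality. -/
theorem discNorm_sub_le {ε : ℝ} {n : ℕ} (hε : 0 < ε) (hn : 0 < n) {f : ℝ → ℝ} {u uh p : H10}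
    (hu : IsWeakSolution ε f u) (huh : IsPGSolution ε n f uh) (hp : p ∈ trialSpace n) :
    discNorm ε n (u - uh) ≤ √(19 / 3) * discNorm ε n (u - p) := by
  have hs : √(19 / 3 : ℝ) ^ 2 = 19 / 3 := Real.sq_sqrt (by norm_num)
  have horth : ∀ v ∈ testSpace n, b ε v (u - uh : H10) = 0 := by
    intro v hv
    have h1 := b_add ε v (u - uh) uh
    rw [sub_add_cancel, hu v, huh.2 v hv] at h1
    linarith
  have hm := Submodule.sub_mem _ huh.1 hp
  have key := complementary_projection_inequality (sq_nonneg (discNorm ε n (u - uh)))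
    (sq_nonneg (discNorm ε n (uh - p))) (K := 19 / 3)
    (D := 3 / 19 * ((ε + 2 * mesh n / 3) ^ 2 * a0 (uh - p : H10) (u - uh : H10) +
      a0 (projT n (uh - p)) (projT n (u - uh)))) (by norm_num) fun t => by
    rw [← discNorm_sq_add_smul, ← hs, ← mul_pow]
    refine pow_le_pow_left₀ (discNorm_nonneg _ _ _) (discNorm_le_of_forall_b_eq hε hn hm ?_) 2
    intro v hv
    rw [b_add, b_smul, horth v hv, mul_zero, add_zero]
  have hup : u - p = uh - p + (1 : ℝ) • (u - uh) := by rw [one_smul]; abel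
  refine (sq_le_sq₀ (discNorm_nonneg _ _ _)
    (mul_nonneg (Real.sqrt_nonneg _) (discNorm_nonneg _ _ _))).1 ?_
  rw [mul_pow, hs, hup, discNorm_sq_add_smul]
  linarith

/-! ## Interpolation error -/

theorem h1Norm_le_of_nodes {n : ℕ} (hn : 0 < n) {u p : H10} (hu : IsH2 u)
    (hp : p ∈ trialSpace n)
    (hnodes : ∀ i : ℕ, i ≤ n → ((u - p : H10) : ℝ → ℝ) (i * mesh n) = 0) :
    h1Norm (u - p : H10) ≤ mesh n * l2Norm (deriv (deriv u)) := by
  have hm := mesh_pos hn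
  obtain ⟨g, hg, hug, hg'⟩ := hu
  set e : H10 := u - p with he
  have hele : ∀ k < n, ∀ x ∈ Ioo ((k : ℝ) * mesh n) ((k + 1) * mesh n),
      deriv (e : ℝ → ℝ) x * deriv (e : ℝ → ℝ) x ≤
        mesh n * ∫ y in ((k : ℝ) * mesh n)..((k + 1) * mesh n), deriv g y * deriv g y := by
    intro k hk
    obtain ⟨α, β, hab⟩ := hp k hk
    have hlt : (k : ℝ) * mesh n < (k + 1) * mesh n := by linarith
    have hder : ∀ x ∈ Ioo ((k : ℝ) * mesh n) ((k + 1) * mesh n),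
        HasDerivAt (e : ℝ → ℝ) (g x - β) x := by
      intro x hx
      have h2 : HasDerivAt (fun y : ℝ => α + β * y) β x := by
        simpa using ((hasDerivAt_id x).const_mul β).const_add α
      have h3 : HasDerivAt (p : ℝ → ℝ) β x := h2.congr_of_eventuallyEq (by
        filter_upwards [isOpen_Ioo.mem_nhds hx] with y hy using hab y (Ioo_subset_Icc_self hy))
      exact (hug x (element_Ioo_subset hk hx)).sub h3
    have hcont : ContinuousOn (e : ℝ → ℝ) (Icc ((k : ℝ) * mesh n) ((k + 1) * mesh n)) :=
      e.2.1.continuousOn.mono (by rw [uIcc_of_le zero_le_one]; exact element_subset hk)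
    have hk' := hnodes (k + 1) hk
    push_cast at hk'
    -- By Rolle, the slope `β` of `p` equals `g ξ` inside the element, so `e' = g - g ξ` there and
    -- is controlled by the element integral of `g'²`.
    obtain ⟨ξ, hξ, hξ0⟩ := exists_hasDerivAt_eq_zero hlt hcont ((hnodes k hk.le).trans hk'.symm)
      hder
    have hmono : ∀ s t : ℝ, (k : ℝ) * mesh n ≤ s → s ≤ t → t ≤ (k + 1) * mesh n →
        (g t - g s) ^ 2 ≤
          mesh n * ∫ y in ((k : ℝ) * mesh n)..((k + 1) * mesh n), deriv g y * deriv g y := by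
      intro s t h1 h2 h3
      have h0s := (element_subset hk ⟨h1, h2.trans h3⟩).1
      have ht1 := (element_subset hk ⟨h1.trans h2, h3⟩).2
      refine (sq_sub_le_integral_deriv hg hg' h0s h2 ht1).trans ?_
      refine mul_le_mul (by linarith) ?_
        (intervalIntegral.integral_nonneg h2 fun _ _ => mul_self_nonneg _) hm.le
      exact intervalIntegral.integral_mono_interval h1 h2 h3
        (Filter.Eventually.of_forall fun _ => mul_self_nonneg _)
        ((int_mul hg' hg').mono_set (element_uIcc_subset hk))
    intro x hx
    rw [(hder x hx).deriv, ← sq, ← sub_eq_zero.1 hξ0]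
    rcases le_total ξ x with hle | hle
    · exact hmono ξ x hξ.1.le hle hx.2.le
    · rw [← neg_sub, neg_sq]
      exact hmono x ξ hx.1.le hle hξ.2.le
  have hint := integral_le_of_elementwise hn (mesh n) (int_mul e.2.2.1 e.2.2.1)
    (int_mul hg' hg') hele
  have hdd : ∫ x in (0 : ℝ)..1, deriv g x * deriv g x =
      ∫ x in (0 : ℝ)..1, deriv (deriv (u : ℝ → ℝ)) x ^ 2 := by
    rw [intervalIntegral.integral_of_le zero_le_one, intervalIntegral.integral_of_le zero_le_one,
      integral_Ioc_eq_integral_Ioo, integral_Ioc_eq_integral_Ioo]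
    refine setIntegral_congr_fun measurableSet_Ioo fun x hx => ?_
    have : deriv (u : ℝ → ℝ) =ᶠ[nhds x] g := by
      filter_upwards [isOpen_Ioo.mem_nhds hx] with y hy using (hug y hy).deriv
    simp only [this.deriv_eq, sq]
  rw [hdd] at hint
  unfold h1Norm l2Norm
  refine (Real.sqrt_le_sqrt hint).trans_eq ?_
  rw [Real.sqrt_mul (by positivity), Real.sqrt_mul_self hm.le]

theorem sqrt_mul_discNorm_le_of_nodes {ε : ℝ} {n : ℕ} (hε : 0 < ε) (hn : 0 < n) {e : H10}
    (he : ∀ i : ℕ, i ≤ n → (e : ℝ → ℝ) (i * mesh n) = 0) :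
    √(19 / 3) * discNorm ε n e ≤ (ε + 2 * mesh n) * h1Norm e := by
  have hm := mesh_pos hn
  have h0 := h1Norm_nonneg (e : ℝ → ℝ)
  have hS : h1Norm (projT n e) ≤ mesh n / 2 * h1Norm e :=
    (h1Norm_projT_le n e).trans (sqrt_l2_self_le_of_nodes hn he)
  have hS2 := pow_le_pow_left₀ (h1Norm_nonneg _) hS 2
  rw [discNorm_eq, ← Real.sqrt_mul (by norm_num), ← h1Norm_sq, ← h1Norm_sq]
  refine Real.sqrt_le_iff.2 ⟨by positivity, ?_⟩
  have h1 : (ε + 2 * mesh n / 3) ^ 2 + (mesh n / 2) ^ 2 ≤ (ε + 2 * mesh n) ^ 2 := by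
    nlinarith [mul_pos hε hm, mul_pos hm hm]
  have h2 := mul_le_mul_of_nonneg_right h1 (sq_nonneg (h1Norm (e : ℝ → ℝ)))
  linarith

end ConvDiff

theorem mainTheorem1 :
    (∀ (ε : ℝ) (n : ℕ), 0 < ε → 0 < n →
      (∀ wh ∈ trialSpace n,
        IsLUB {r : ℝ | ∃ v ∈ testSpace n, r = b ε v wh / h1Norm v} (discNorm ε n wh)) ∧
      (∀ (f : ℝ → ℝ) (u uh : H10), MemLp f 2 (volume.restrict (Ioo (0 : ℝ) 1)) →
        IsWeakSolution ε f u → IsPGSolution ε n f uh →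
        discNorm ε n (u - uh) ≤ √(19 / 3) * ⨅ p : trialSpace n, discNorm ε n (u - p))) ∧
    (∃ C : ℝ, 0 < C ∧ ∀ (ε : ℝ) (n : ℕ) (f : ℝ → ℝ) (u uh : H10), 0 < ε → 0 < n →
      MemLp f 2 (volume.restrict (Ioo (0 : ℝ) 1)) →
      IsWeakSolution ε f u → IsPGSolution ε n f uh → IsH2 u →
      discNorm ε n (u - uh) ≤
        ε * (C * l2Norm (deriv (deriv u)) * mesh n) +
          C * l2Norm (deriv (deriv u)) * mesh n ^ 2) := by
  -- The value `C = 2` comes from `(ε + 2h) · h ‖u''‖`, the bound obtained by inserting the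
  -- interpolant.
  refine ⟨fun ε n hε hn => ⟨fun wh hwh => isLUB_discNorm ε hn hwh, ?_⟩, 2, two_pos, ?_⟩
  · intro f u uh _ hu huh
    rw [Real.mul_iInf_of_nonneg (Real.sqrt_nonneg _)]
    exact le_ciInf fun p => discNorm_sub_le hε hn hu huh p.2
  · intro ε n f u uh hε hn _ hu huh hu2
    have hm := mesh_pos hn
    obtain ⟨p, hp, hpu⟩ := exists_interpolant hn u
    have hnodes : ∀ i : ℕ, i ≤ n → ((u - p : H10) : ℝ → ℝ) (i * mesh n) = 0 :=
      fun i hi => sub_eq_zero.2 (hpu i hi).symm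
    have h0 : 0 ≤ l2Norm (deriv (deriv (u : ℝ → ℝ))) := Real.sqrt_nonneg _
    refine (discNorm_sub_le hε hn hu huh hp).trans ?_
    refine (sqrt_mul_discNorm_le_of_nodes hε hn hnodes).trans ?_
    refine (mul_le_mul_of_nonneg_left (h1Norm_le_of_nodes hn hu2 hp hnodes)
      (by positivity)).trans ?_
    have := mul_nonneg (mul_nonneg hε.le hm.le) h0
    linarith
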